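/- Let $p$ be a prime, let $k$ be a field of characteristic $p$, and let $q\ge 2$ be an integer. **Definitions.** For a set $X$ of permutations of $\mathbb N$, let $\operatorname{supp}X$ be the set of points moved by some element of $X$. Let $\mathcal F$ be the family of finite nonempty sets $X\neq\{1\}$ of finitary permutations of $\mathbb N$. Let $\mathcal S^q\subset\mathcal F$ consist of those $X\in\mathcal F$ such that every $\rho\in X$ is a product of disjoint $q$-cycles and satisfies $\operatorname{supp}\rho=\operatorname{supp}X$. For $X\in\mathcal F$ let $G_X=\operatorname{Sym}(\operatorname{supp}X)$, acting by conjugation; let $S_X=C_{G_X}(X)$ be the pointwise stabilizer of $X$ in $G_X$; let $Q_X$ be a Sylow $p$-subgroup of $S_X$; and let $\Xi_X=\bigcup_{g\in G_X}X^g$. * A *vertex* of an indecomposable $kG$-module $M$ is a subgroup $Q\le G$ that is minimal among the subgroups $H\le G$ such that $M$ is a direct summand of $\operatorname{Ind}_H^G L$ for some $kH$-module $L$. * $X\in\mathcal S^q$ is a *fixed point set* if some indecomposable direct summand of the permutation $kG_X$-module $k\Xi_X$ has a vertex $Q$ with $X=\operatorname{Fix}_{\Xi_X}(Q)$. * $X$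 is *exact* if $\operatorname{supp}Q_X=\operatorname{supp}X$, i.e. $Q_X$ has no fixed point on $\operatorname{supp}X$. * $X\in\mathcal F$ is *irreducible* if there are no $Y,Z\in\mathcal F$ with disjoint supports such that $X=\{yz: y\in Y,\ z\in Z\}$. For a positive integer $r$, choose conjugates $Y_i=\sigma_iY\sigma_i^{-1}$ ($\sigma_i\in\operatorname{Sym}(\mathbb N)$, $1\le i\le r$) of $Y$ with pairwise disjoint supports. Then $$*^rY=\Big\{\prod_{i=1}^r\sigma_iy_i\sigma_i^{-1}: y_1,\dots,y_r\in Y\Big\},\qquad \Delta^rY=\Big\{\prod_{i=1}^r\sigma_iy\sigma_i^{-1}: y\in Y\Big\}.$$ Up to conjugation in $\operatorname{Sym}(\mathbb N)$ these sets do not depend on the choice of the $\sigma_i$. **Theorem.** Let $Y\in\mathcal S^q$ be an exact irreducible fixed point set. Let $s$ be an integer with $1\le s<p$, and let $t=p^i$ with $i\ge 0$. Then, for every choice of the $\sigma_i$: 1. $*^sY$ belongs to $\mathcal S^q$ and is a fixed point set. 2. $\Delta^tY$ belongs to $\mathcal S^q$ and is a fixed point set; moreover $\Delta^tY$ is irreducible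 if $|Y|>1$ or $t=1$. -/

import Mathlib

namespace FixedPointSets

open Equiv

universe u v w

/-! ### Summands, indecomposability and vertices of representations of a group -/

section Representations

variable {k : Type u} [Field k] {G : Type v} [Group G]

/-- `ρ` is (isomorphic to) a direct summand, or component, of `σ`: the identity of `ρ` factors
through `σ` by maps that commute with the action of `G`. -/
def IsSummand {V : Type*} {W : Type*} [AddCommGroup V] [Module k V] [AddCommGroup W] [Module k W]
    (ρ : Representation k G V) (σ : Representation k G W) : Prop :=
  ∃ (i : Representation.IntertwiningMap ρ σ) (r : Representation.IntertwiningMap σ ρ),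
    ∀ v : V, r (i v) = v

/-- `ρ` is nonzero, and it is not the direct sum of two nonzero subrepresentations. -/
def IsIndecomposable {V : Type*} [AddCommGroup V] [Module k V]
    (ρ : Representation k G V) : Prop :=
  Nontrivial V ∧ ∀ A B : Subrepresentation ρ, IsCompl A.toSubmodule B.toSubmodule →
    A.toSubmodule = ⊥ ∨ B.toSubmodule = ⊥

/-- `ρ` is a component of a representation induced from the subgroup `H`. -/
def IsComponentOfInduced {V : Type w} [AddCommGroup V] [Module k V]
    (ρ : Representation k G V) (H : Subgroup G) : Prop :=
  ∃ (W : Type w) (_ : AddCommGroup W) (_ : Module k W) (τ : Representation k H W),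
    IsSummand ρ (Representation.ind H.subtype τ)

/-- `Q` is a vertex of `ρ`: it is minimal, with respect to inclusion, among the subgroups `H` such
that `ρ` is a component of a representation induced from `H`. -/
def IsVertex {V : Type w} [AddCommGroup V] [Module k V]
    (ρ : Representation k G V) (Q : Subgroup G) : Prop :=
  Minimal (IsComponentOfInduced ρ) Q

/-- A subset `X` of a `G`-set `Ω` is a fixed point set (over `k`) if it is the set of fixed points
of a vertex `Q` of some indecomposable summand of the permutation module `kΩ`. -/
def IsFixedPointSubset (k : Type u) [Field k] (G : Type v) [Group G]
    {Ω : Type} [MulAction G Ω] (X : Set Ω) : Prop :=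
  ∃ (V : Type u) (_ : AddCommGroup V) (_ : Module k V) (ρ : Representation k G V),
    IsIndecomposable ρ ∧ IsSummand ρ (Representation.ofMulAction k G Ω) ∧
    ∃ Q : Subgroup G, IsVertex ρ Q ∧ X = MulAction.fixedPoints Q Ω

end Representations

/-! ### Finite sets of finitary permutations of `ℕ` -/

/-- The support of a permutation. -/
def supp (ρ : Perm ℕ) : Set ℕ := {n | ρ n ≠ n}

/-- The support of a set of permutations. -/
def setSupp (X : Set (Perm ℕ)) : Set ℕ := ⋃ ρ ∈ X, supp ρ

/-- The finite nonempty sets, other than `{1}`, of finitary permutations of `ℕ`. -/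
def familyF : Set (Set (Perm ℕ)) :=
  {X | X.Finite ∧ X.Nonempty ∧ X ≠ {1} ∧ ∀ ρ ∈ X, (supp ρ).Finite}

/-- `ρ` is a product of pairwise disjoint `q`-cycles. -/
def IsProductOfCycles (q : ℕ) (ρ : Perm ℕ) : Prop :=
  ∃ l : List (Perm ℕ), (∀ c ∈ l, c.IsCycle ∧ (supp c).ncard = q) ∧
    l.Pairwise Perm.Disjoint ∧ l.prod = ρ

/-- The family `𝒮^q`: members of `familyF` all of whose elements are products of `q`-cycles and
have the same support. -/
def familyS (q : ℕ) : Set (Set (Perm ℕ)) :=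
  {X | X ∈ familyF ∧ ∀ ρ ∈ X, IsProductOfCycles q ρ ∧ supp ρ = setSupp X}

/-- `Sym(α)`, as the group of permutations of `ℕ` that fix every point outside `α`. -/
def symOn (α : Set ℕ) : Subgroup (Perm ℕ) := fixingSubgroup (Perm ℕ) αᶜ

/-- `G_X = Sym(supp X)`. -/
abbrev groupG (X : Set (Perm ℕ)) : Subgroup (Perm ℕ) := symOn (setSupp X)

/-- `S_X`: the pointwise stabilizer of `X` in `G_X`, acting by conjugation, that is, the
centralizer of `X` in `G_X`. -/
def groupS (X : Set (Perm ℕ)) : Subgroup (Perm ℕ) := groupG X ⊓ Subgroup.centralizer X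

/-- `Ξ_X`: the union of the conjugates of `X` under `G_X`. -/
def Xi (X : Set (Perm ℕ)) : Set (Perm ℕ) := {x | ∃ g ∈ groupG X, ∃ y ∈ X, x = g * y * g⁻¹}

/-- `G_X` acts on `Ξ_X` by conjugation. -/
instance conjAction (X : Set (Perm ℕ)) : MulAction (groupG X) (Xi X) where
  smul g x := ⟨g * x * (g : Perm ℕ)⁻¹, by
    obtain ⟨x, h, hh, y, hy, rfl⟩ := x
    exact ⟨g * h, mul_mem g.2 hh, y, hy, by simp [mul_assoc]⟩⟩
  one_smul x := Subtype.ext (by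
    change ((1 : groupG X) : Perm ℕ) * x * ((1 : groupG X) : Perm ℕ)⁻¹ = x
    simp)
  mul_smul g h x := Subtype.ext (by
    change ((g * h : groupG X) : Perm ℕ) * x * ((g * h : groupG X) : Perm ℕ)⁻¹ =
      g * (h * x * (h : Perm ℕ)⁻¹) * (g : Perm ℕ)⁻¹
    simp [mul_assoc])

/-- `X` is a fixed point set (over `k`): there is an indecomposable summand of the permutation
`kG_X`-module `kΞ_X` with a vertex `Q` such that `X` is the set of fixed points of `Q` on `Ξ_X`. -/
def IsFixedPointSet (k : Type u) [Field k] (X : Set (Perm ℕ)) : Prop :=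
  IsFixedPointSubset k (groupG X) {x : Xi X | (x : Perm ℕ) ∈ X}

/-- `X` is exact: a Sylow `p`-subgroup `Q_X` of `S_X` has the same support as `X`, that is, it has
no fixed point on `supp X`. (The Sylow `p`-subgroups of `S_X` are conjugate in `S_X`, so the choice
of one does not matter.) -/
def IsExact (p : ℕ) (X : Set (Perm ℕ)) : Prop :=
  ∀ Q : Sylow p (groupS X), setSupp {g | ∃ x ∈ Q, (x : Perm ℕ) = g} = setSupp X

/-- `X` is irreducible: it is not a product `Y * Z` of members of `familyF` with disjoint
supports. -/
def IsIrreducibleSet (X : Set (Perm ℕ)) : Prop :=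
  ¬ ∃ Y ∈ familyF, ∃ Z ∈ familyF, Disjoint (setSupp Y) (setSupp Z) ∧
    X = {g | ∃ y ∈ Y, ∃ z ∈ Z, g = y * z}

/-! ### The `s`-fold product and the `s`-fold diagonal product

These are defined up to conjugation in `Sym(ℕ)`. A representative of either is determined by
permutations `σ 0, …, σ (s - 1)` of `ℕ` that move `X` to copies with disjoint supports. -/

/-- The conjugates of `X` by `σ 0, …, σ (s - 1)` have pairwise disjoint supports. -/
def IsPlacement (X : Set (Perm ℕ)) {s : ℕ} (σ : Fin s → Perm ℕ) : Prop :=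
  ∀ i j, i ≠ j → Disjoint (σ i '' setSupp X) (σ j '' setSupp X)

/-- The image of `(y 0, …, y (s - 1))` under the embedding of `Sym(supp X)^s` that is given by a
placement `σ`. -/
def embed {s : ℕ} (σ : Fin s → Perm ℕ) (y : Fin s → Perm ℕ) : Perm ℕ :=
  (List.ofFn fun i => σ i * y i * (σ i)⁻¹).prod

/-- `*^s X`: the image of `X^s`. -/
def starPower (X : Set (Perm ℕ)) {s : ℕ} (σ : Fin s → Perm ℕ) : Set (Perm ℕ) :=
  {g | ∃ y : Fin s → Perm ℕ, (∀ i, y i ∈ X) ∧ g = embed σ y}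

/-- `Δ^s X`: the image of the diagonal of `X^s`. -/
def diagPower (X : Set (Perm ℕ)) {s : ℕ} (σ : Fin s → Perm ℕ) : Set (Perm ℕ) :=
  {g | ∃ y ∈ X, g = embed σ fun _ => y}

/-- The support of a conjugate of `X` is the translate of the support of `X`. -/
theorem setSupp_conj (X : Set (Perm ℕ)) (σ : Perm ℕ) :
    setSupp {g | ∃ y ∈ X, g = σ * y * σ⁻¹} = σ '' setSupp X := by
  ext n
  simp only [setSupp, supp, Set.mem_iUnion, Set.mem_ofPred_eq, Set.mem_image, exists_prop]
  constructor
  · rintro ⟨_, ⟨y, hy, rfl⟩, hn⟩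
    refine ⟨σ⁻¹ n, ⟨y, hy, fun h => hn ?_⟩, by simp⟩
    change σ (y (σ⁻¹ n)) = n
    rw [h]
    exact σ.apply_symm_apply n
  · rintro ⟨m, ⟨y, hy, hm⟩, rfl⟩
    exact ⟨_, ⟨y, hy, rfl⟩, by simpa [Perm.mul_apply] using hm⟩

/-- Placements exist. -/
theorem exists_isPlacement {X : Set (Perm ℕ)} (hX : X ∈ familyF) (s : ℕ) :
    ∃ σ : Fin s → Perm ℕ, IsPlacement X σ := by
  have hfin : (setSupp X).Finite := hX.1.biUnion fun ρ hρ => hX.2.2.2 ρ hρ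
  obtain ⟨N, hN⟩ := hfin.bddAbove
  let f : ℕ → ℕ → ℕ := fun i n =>
    if n < N + 1 then n + i * (N + 1)
    else if i * (N + 1) ≤ n ∧ n < i * (N + 1) + (N + 1) then n - i * (N + 1) else n
  have hf : ∀ i, Function.Involutive (f i) := by
    intro i n
    rcases Nat.eq_zero_or_pos i with rfl | hi
    · simp [f]
    · have : N + 1 ≤ i * (N + 1) := Nat.le_mul_of_pos_left _ hi
      simp only [f]
      split_ifs <;> omega
  refine ⟨fun i => (hf i).toPerm, fun i j hij => ?_⟩
  rw [Set.disjoint_left]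
  rintro _ ⟨a, ha, rfl⟩ ⟨b, hb, hab⟩
  have ha' : a < N + 1 := Nat.lt_succ_of_le (hN ha)
  have hb' : b < N + 1 := Nat.lt_succ_of_le (hN hb)
  simp only [Function.Involutive.coe_toPerm, f, ha', hb', if_true] at hab
  apply hij
  have h1 := congrArg (· / (N + 1)) hab
  simp only [Nat.add_mul_div_right _ _ (Nat.succ_pos N), Nat.div_eq_of_lt ha',
    Nat.div_eq_of_lt hb', zero_add] at h1
  exact Fin.ext h1.symm

end FixedPointSets

open FixedPointSets

/-! The argument rests on a local criterion. Let `G` be a finite group acting on a finite set `Ω`.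
Then `X ⊆ Ω` is a fixed point set exactly when `X = Fix Q` for some `p`-subgroup `Q` that is Sylow
in the pointwise stabilizer of `X`, and the permutation module `kX` of the group `Γ` of permutations
of `X` induced by `G` has a nonzero projective summand. The two directions are
`IsFixedPointSubset.exists_vertex` and `isFixedPointSubset_of_hasProjectiveIdempotent`.

The criterion is proved with matrices. Summands of `kΩ` correspond to idempotent `G`-invariant
matrices, and Higman's criterion turns "component of a representation induced from `Q`" into
"relative trace from `Q`". Restricting `Q`-invariant matrices to `Fix Q` is multiplicative (the
Brauer homomorphism). It sends a relative trace from `Q` to the index of `Q` in the pointwise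
stabilizer times a sum over `Γ`. So an idempotent with vertex `Q` restricts to a nonzero idempotent
that is a sum over `Γ`, and conversely such an idempotent on `X` can be lifted.

For both powers the new `p`-group is a wreath product `Q ≀ P` acting on the blocks, with `P` trivial
for the star power and `P` the translations of `Fin t` for the diagonal power; the latter form a
`p`-group because `t` is a power of `p`. Exactness forces a permutation centralized by `Q ≀ P` to
preserve each block, so its coordinates lie in `Y` and are constant on `P`-orbits
(`mem_invariantPower_of_commute`).

It remains to find a projective summand. For the star power, irreducibility of `Y` makes every
normalizing element permute the blocks, so the induced group lies in `Γ ≀ Sym(s)`. There the `s`-th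
tensor power of the idempotent works because `s!` is invertible for `s < p`. For the diagonal power,
finite group actions can be cancelled: if `t` copies of two actions are isomorphic, so are the
actions. Hence every permutation induced on the diagonal is already induced on `Y`. -/

open FixedPointSets

/-! ### Sums over cosets, and sums over sets with a `p`-group action. -/

namespace FixedPointSets

open scoped Classical in
/-- The sum of `F` over representatives of the left cosets of `H`. -/
noncomputable def cosetSum {G M : Type*} [Group G] [Finite G] [AddCommMonoid M] (H : Subgroup G)
    (F : G → M) : M :=
  haveI := Fintype.ofFinite (G ⧸ H)
  ∑ q : G ⧸ H, F q.out

/-- `F` is constant on the left cosets of `H`. -/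
def RightInvariant {G M : Type*} [Group G] (H : Subgroup G) (F : G → M) : Prop :=
  ∀ g, ∀ h ∈ H, F (g * h) = F g

section CosetSum

variable {G M N : Type*} [Group G] [AddCommMonoid M] [AddCommMonoid N]

theorem RightInvariant.apply_eq {M : Type*} {H : Subgroup G} {F : G → M} (hF : RightInvariant H F)
    {a b : G} (h : (a : G ⧸ H) = b) : F a = F b := by
  have := hF a _ (QuotientGroup.eq.1 h)
  simpa using this.symm

theorem RightInvariant.apply_out {M : Type*} {H : Subgroup G} {F : G → M}
    (hF : RightInvariant H F) (a : G) : F (a : G ⧸ H).out = F a :=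
  hF.apply_eq (by simp)

theorem cosetSum_eq [Finite G] (H : Subgroup G) (F : G → M) [Fintype (G ⧸ H)] :
    cosetSum H F = ∑ q : G ⧸ H, F q.out := by
  unfold cosetSum
  congr!

theorem map_cosetSum [Finite G] {E : Type*} [FunLike E M N] [AddMonoidHomClass E M N] (φ : E)
    (H : Subgroup G) (F : G → M) : φ (cosetSum H F) = cosetSum H fun g => φ (F g) := by
  classical
  have := Fintype.ofFinite (G ⧸ H)
  simp only [cosetSum_eq, map_sum]

theorem cosetSum_mul_left [Finite G] {H : Subgroup G} {F : G → M} (hF : RightInvariant H F)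
    (x : G) : cosetSum H (fun g => F (x * g)) = cosetSum H F := by
  classical
  have := Fintype.ofFinite (G ⧸ H)
  simp only [cosetSum_eq]
  refine Fintype.sum_equiv (MulAction.toPerm x) _ _ fun q => ?_
  refine hF.apply_eq ?_
  rw [← smul_eq_mul, ← MulAction.Quotient.smul_coe]
  simp

/-- Transitivity of transfer: representatives of `G/Q` times representatives of `Q/R` represent
`G/R`. -/
theorem cosetSum_eq_cosetSum [Finite G] {R Q : Subgroup G} (hRQ : R ≤ Q) {F : G → M}
    (hF : RightInvariant R F) :
    cosetSum R F = cosetSum Q fun g => cosetSum (R.subgroupOf Q) fun u => F (g * u) := by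
  classical
  have := Fintype.ofFinite (G ⧸ R)
  have := Fintype.ofFinite (G ⧸ Q)
  have := Fintype.ofFinite (Q ⧸ R.subgroupOf Q)
  simp only [cosetSum_eq]
  rw [← Fintype.sum_prod_type']
  symm
  refine Fintype.sum_equiv (Subgroup.quotientEquivProdOfLE hRQ).symm _ _ fun ⟨q, u⟩ => ?_
  induction u using QuotientGroup.induction_on with | H u => ?_
  have h1 : (Subgroup.quotientEquivProdOfLE hRQ).symm (q, (u : Q ⧸ R.subgroupOf Q)) =
    ((q.out * u : G) : G ⧸ R) := rfl
  rw [h1, hF.apply_out]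
  refine RightInvariant.apply_out (F := fun u : Q => F (q.out * u)) (H := R.subgroupOf Q) ?_ u
  intro g h hh
  have := hF (q.out * g) h hh
  simpa [mul_assoc] using this

theorem cosetSum_congr [Finite G] {H : Subgroup G} {F F' : G → M} (h : ∀ g, F g = F' g) :
    cosetSum H F = cosetSum H F' := by
  rw [funext h]

theorem cosetSum_const [Finite G] (H : Subgroup G) (m : M) :
    cosetSum H (fun _ => m) = H.index • m := by
  classical
  have := Fintype.ofFinite (G ⧸ H)
  simp only [cosetSum_eq, Finset.sum_const, Finset.card_univ, Subgroup.index,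
    Nat.card_eq_fintype_card]

theorem cosetSum_eq_relIndex_nsmul [Finite G] {R Q : Subgroup G} (hRQ : R ≤ Q) {F : G → M}
    (hF : RightInvariant Q F) :
    cosetSum R F = cosetSum Q fun g => R.relIndex Q • F g := by
  rw [cosetSum_eq_cosetSum hRQ fun g h hh => hF g h (hRQ hh)]
  refine cosetSum_congr fun g => ?_
  rw [Subgroup.relIndex, ← cosetSum_const]
  exact cosetSum_congr fun u => hF g u u.2

end CosetSum

/-- Over a field of characteristic `p`, the sum of an invariant function on a finite set with an
action of a `p`-group vanishes if the function vanishes at the fixed points. -/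
theorem sum_eq_zero_of_isPGroup {k : Type*} [Field k] {p : ℕ} [Fact p.Prime] [CharP k p]
    {Q Λ : Type*} [Group Q] [Finite Q] (hQ : IsPGroup p Q) [MulAction Q Λ] [Fintype Λ] (F : Λ → k)
    (hF : ∀ (u : Q) l, F (u • l) = F l) (h0 : ∀ l, (∀ u : Q, u • l = l) → F l = 0) :
    ∑ l, F l = 0 := by
  classical
  rw [← Finset.sum_fiberwise_of_maps_to (t := Finset.univ.image F) (g := F)
    fun l _ => Finset.mem_image_of_mem _ (Finset.mem_univ l)]
  refine Finset.sum_eq_zero fun c _ => ?_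
  rw [Finset.sum_congr rfl (g := fun _ => c) fun l hl => (Finset.mem_filter.1 hl).2,
    Finset.sum_const, nsmul_eq_mul]
  by_cases hc : c = 0
  · simp [hc]
  suffices h : p ∣ Nat.card {l // F l = c} by
    rw [Nat.card_eq_fintype_card, Fintype.card_subtype] at h
    rw [(CharP.cast_eq_zero_iff k p _).2 h, zero_mul]
  let A : SubMulAction Q Λ := ⟨{l | F l = c}, fun u l hl => (hF u l).trans hl⟩
  have h1 := hQ.card_modEq_card_fixedPoints A
  have h2 : IsEmpty (MulAction.fixedPoints Q A) := by
    refine ⟨fun ⟨⟨l, hl⟩, h⟩ => hc ?_⟩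
    rw [← (show F l = c from hl)]
    exact h0 l fun u => congrArg Subtype.val (h u)
  have h3 : Nat.card (MulAction.fixedPoints Q A) = 0 := Nat.card_of_isEmpty
  rw [h3] at h1
  exact Nat.modEq_zero_iff_dvd.1 h1

end FixedPointSets

/-! ### Relative traces and Higman's criterion. -/

namespace FixedPointSets

section RelativeTrace

variable {k G V W : Type*} [Field k] [Group G] [AddCommGroup V] [Module k V] [AddCommGroup W] [Module k W]

/-- `f` is the relative trace, from `H` to `G`, of an endomorphism that commutes with `H`. -/
def IsRelTrace [Finite G] (ρ : Representation k G V) (H : Subgroup G) (f : V →ₗ[k] V) : Prop :=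
  ∃ θ : V →ₗ[k] V, (∀ h ∈ H, ∀ v, θ (ρ h v) = ρ h (θ v)) ∧
    f = cosetSum H fun g => ρ g ∘ₗ θ ∘ₗ ρ g⁻¹

theorem rightInvariant_conj {ρ : Representation k G V} {H : Subgroup G} {θ : V →ₗ[k] V}
    (hθ : ∀ h ∈ H, ∀ v, θ (ρ h v) = ρ h (θ v)) :
    RightInvariant H fun g => ρ g ∘ₗ θ ∘ₗ ρ g⁻¹ := by
  intro g h hh
  ext v
  simp [hθ h⁻¹ (inv_mem hh)]

/-- Equivariant maps pass through each conjugate in the sum. This moves traces between a summand and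
the ambient module, and for `ρ = σ` it says that traces absorb equivariant endomorphisms on both
sides. -/
theorem IsRelTrace.comp [Finite G] {ρ : Representation k G V} {σ : Representation k G W} {H : Subgroup G}
    {f : V →ₗ[k] V} (hf : IsRelTrace ρ H f) (i : V →ₗ[k] W) (r : W →ₗ[k] V)
    (hi : ∀ g v, i (ρ g v) = σ g (i v)) (hr : ∀ g v, r (σ g v) = ρ g (r v)) :
    IsRelTrace σ H (i ∘ₗ f ∘ₗ r) := by
  obtain ⟨θ, hθ, rfl⟩ := hf
  refine ⟨i ∘ₗ θ ∘ₗ r, fun h hh v => by simp [hr, hi, hθ h hh], ?_⟩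
  let φ : (V →ₗ[k] V) →+ (W →ₗ[k] W) :=
    { toFun := fun f => i ∘ₗ f ∘ₗ r
      map_zero' := by ext; simp
      map_add' := fun a b => by ext; simp }
  change φ _ = _
  rw [map_cosetSum]
  refine cosetSum_congr fun g => ?_
  ext v
  simp [φ, hr, hi]

theorem cosetSum_apply [Finite G] (H : Subgroup G) (F : G → V →ₗ[k] W) (v : V) :
    cosetSum H F v = cosetSum H fun g => F g v :=
  map_cosetSum (LinearMap.applyₗ v) H F

/-- A relative trace from `Q` is a relative trace from any subgroup of `Q` of invertible index. -/
theorem IsRelTrace.of_le [Finite G] {ρ : Representation k G V} {R Q : Subgroup G} (hRQ : R ≤ Q)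
    (hindex : (R.relIndex Q : k) ≠ 0) {f : V →ₗ[k] V} (hf : IsRelTrace ρ Q f) :
    IsRelTrace ρ R f := by
  obtain ⟨θ, hθ, rfl⟩ := hf
  refine ⟨(R.relIndex Q : k)⁻¹ • θ, fun h hh v => by simp [hθ h (hRQ hh)], ?_⟩
  rw [cosetSum_eq_relIndex_nsmul hRQ]
  · refine cosetSum_congr fun g => ?_
    ext v
    rw [← Nat.cast_smul_eq_nsmul k]
    simp [smul_smul, hindex]
  · exact rightInvariant_conj fun h hh v => by simp [hθ h hh]

/-- The linear map from an induced representation that is given by its values on the vectors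
`⟦g ⊗ v⟧`. -/
noncomputable def indDesc {H : Subgroup G} (τ : Representation k H V) (F : G → V →ₗ[k] W)
    (hF : ∀ (h : H) g v, F (h * g) (τ h v) = F g v) :
    Representation.IndV H.subtype τ →ₗ[k] W :=
  Representation.Coinvariants.lift _
    (TensorProduct.lift <| (Finsupp.lift _ _ _ F) ∘ₗ
      (MonoidAlgebra.coeffLinearEquiv k).toLinearMap)
    fun h => by
      ext g x
      simp only [LinearMap.coe_comp, Function.comp_apply, MonoidAlgebra.lsingle_apply]
      simp [Representation.ofMulAction_single, hF]

/-- The vector `⟦g ⊗ v⟧` of an induced representation. -/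
noncomputable def indVec {H : Subgroup G} (τ : Representation k H V) (g : G) :
    V →ₗ[k] Representation.IndV H.subtype τ :=
  Representation.IndV.mk _ _ g

theorem indVec_hom_ext {H : Subgroup G} {τ : Representation k H V}
    {f f' : Representation.IndV H.subtype τ →ₗ[k] W}
    (h : ∀ g v, f (indVec τ g v) = f' (indVec τ g v)) : f = f' :=
  Representation.IndV.hom_ext _ _ fun g => LinearMap.ext (h g)

theorem ind_indVec {H : Subgroup G} (τ : Representation k H V) (x g : G) (v : V) :
    Representation.ind H.subtype τ x (indVec τ g v) = indVec τ (g * x⁻¹) v :=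
  Representation.ind_mk _ _ _ _ _

theorem indDesc_indVec {H : Subgroup G} (τ : Representation k H V) (F : G → V →ₗ[k] W)
    (hF : ∀ (h : H) g v, F (h * g) (τ h v) = F g v) (g : G) (v : V) :
    indDesc τ F hF (indVec τ g v) = F g v := by
  simp [indDesc, indVec, Representation.IndV.mk]

theorem indVec_mul {H : Subgroup G} (τ : Representation k H V) (h : H) (g : G) (v : V) :
    indVec τ (h * g) (τ h v) = indVec τ g v := by
  have := Representation.Coinvariants.mk_self_apply
    (Representation.tprod ((Representation.leftRegular k G).comp H.subtype) τ) h
    (MonoidAlgebra.single g 1 ⊗ₜ[k] v)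
  simpa [Representation.ofMulAction_single, indVec] using this

/-- Induced representations are relatively projective. -/
theorem isRelTrace_id_ind [Finite G] {H : Subgroup G} (τ : Representation k H V) :
    IsRelTrace (Representation.ind H.subtype τ) H LinearMap.id := by
  classical
  -- The endomorphism `θ` is the projection onto the block of the trivial coset. Its conjugates are
  -- the projections onto the other blocks, and they sum to the identity.
  let F : G → V →ₗ[k] Representation.IndV H.subtype τ := fun g =>
    if g ∈ H then indVec τ g else 0
  have hF : ∀ (h : H) g v, F (h * g) (τ h v) = F g v := by
    intro h g v
    by_cases hg : g ∈ H
    · simp only [F, hg, mul_mem h.2 hg, if_true, indVec_mul]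
    · simp [F, hg, Subgroup.mul_mem_cancel_left H h.2]
  have hθ : ∀ h ∈ H, ∀ v, indDesc τ F hF (Representation.ind H.subtype τ h v) =
      Representation.ind H.subtype τ h (indDesc τ F hF v) := by
    intro h hh v
    have : indDesc τ F hF ∘ₗ (Representation.ind H.subtype τ h) =
      (Representation.ind H.subtype τ h) ∘ₗ indDesc τ F hF := by
      refine indVec_hom_ext fun g v => ?_
      simp only [LinearMap.comp_apply, ind_indVec, indDesc_indVec]
      by_cases hg : g ∈ H
      · simp only [F, hg, mul_mem hg (inv_mem hh), if_true, ind_indVec]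
      · simp [F, hg, Subgroup.mul_mem_cancel_right H (inv_mem hh)]
    exact LinearMap.congr_fun this v
  refine ⟨indDesc τ F hF, hθ, ?_⟩
  refine indVec_hom_ext fun g v => ?_
  have := Fintype.ofFinite (G ⧸ H)
  simp only [LinearMap.comp_apply, LinearMap.id_apply, cosetSum_apply]
  rw [cosetSum_eq, Fintype.sum_eq_single ((g⁻¹ : G) : G ⧸ H)]
  · have : g * ((g⁻¹ : G) : G ⧸ H).out ∈ H := by
      have := QuotientGroup.eq (s := H) (a := g⁻¹) (b := ((g⁻¹ : G) : G ⧸ H).out)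
      simpa using this.1 (by simp)
    simp only [ind_indVec, indDesc_indVec, F, inv_inv, this, if_true, mul_inv_cancel_right]
  · intro q hq
    have : g * q.out ∉ H := by
      intro h
      apply hq
      have := (QuotientGroup.eq (s := H) (a := g⁻¹) (b := q.out)).2 (by simpa using h)
      simpa using this.symm
    simp only [ind_indVec, indDesc_indVec, F, inv_inv, this, if_false,
      LinearMap.zero_apply, map_zero]

end RelativeTrace

/-- Higman's criterion. -/
theorem isComponentOfInduced_iff {k : Type*} {G : Type*} {V : Type*} [Field k] [Group G] [Finite G]
    [AddCommGroup V] [Module k V] (ρ : Representation k G V) (H : Subgroup G) :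
    IsComponentOfInduced ρ H ↔ IsRelTrace ρ H LinearMap.id := by
  constructor
  · rintro ⟨W, _, _, τ, i, r, hir⟩
    have := (isRelTrace_id_ind τ).comp (σ := ρ) r.toLinearMap i.toLinearMap
      (fun g v => r.isIntertwining _ _ g v) (fun g v => i.isIntertwining _ _ g v)
    convert this
    ext v
    exact (hir v).symm
  · rintro ⟨θ, hθ, h1⟩
    -- The section of the multiplication map `⟦g ⊗ v⟧ ↦ g⁻¹ v` is `v ↦ ∑ ⟦g⁻¹ ⊗ θ (g⁻¹ v)⟧`;
    -- composing the two gives the trace of `θ`, which is the identity.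
    let F : V → G → Representation.IndV H.subtype (ρ.comp H.subtype) := fun v g =>
      indVec (ρ.comp H.subtype) g⁻¹ (θ (ρ g⁻¹ v))
    have hF : ∀ v, RightInvariant H (F v) := by
      intro v g h hh
      have := indVec_mul (ρ.comp H.subtype) ⟨h⁻¹, inv_mem hh⟩ g⁻¹ (θ (ρ g⁻¹ v))
      simp only [F, mul_inv_rev, map_mul, Module.End.mul_apply]
      rw [← this, hθ _ (inv_mem hh)]
      rfl
    let i : V →ₗ[k] Representation.IndV H.subtype (ρ.comp H.subtype) :=
      cosetSum H fun g => indVec (ρ.comp H.subtype) g⁻¹ ∘ₗ θ ∘ₗ ρ g⁻¹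
    have hi : ∀ v, i v = cosetSum H (F v) := fun v => cosetSum_apply _ _ _
    let r : Representation.IndV H.subtype (ρ.comp H.subtype) →ₗ[k] V :=
      indDesc (ρ.comp H.subtype) (fun g => ρ g⁻¹) fun h g v => by simp
    refine ⟨V, _, _, ρ.comp H.subtype, i.intertwiningMap_of_isIntertwiningMap _ _ fun x v => ?_,
      r.intertwiningMap_of_isIntertwiningMap _ _ fun x v => ?_, fun v => ?_⟩
    · rw [hi, hi, map_cosetSum, ← cosetSum_mul_left (hF (ρ x v)) x]
      refine cosetSum_congr fun g => ?_
      simp only [F]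
      rw [ind_indVec]
      simp
    · have : r ∘ₗ Representation.ind H.subtype (ρ.comp H.subtype) x = ρ x ∘ₗ r := by
        refine indVec_hom_ext fun g v => ?_
        simp only [LinearMap.comp_apply, ind_indVec, r, indDesc_indVec]
        simp
      exact LinearMap.congr_fun this v
    · change r (i v) = v
      rw [hi, map_cosetSum]
      conv_rhs => rw [← LinearMap.id_apply (R := k) v, h1, cosetSum_apply]
      refine cosetSum_congr fun g => ?_
      simp only [F, r, indDesc_indVec]
      simp

end FixedPointSets

/-! ### Invariant matrices and the Brauer restriction to fixed points. -/

namespace FixedPointSets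

theorem inv_mul_out_mem {G : Type*} [Group G] {H : Subgroup G} {q : G ⧸ H} {u : G}
    (h : u • q = q) : q.out⁻¹ * u * q.out ∈ H := by
  rw [mul_assoc, ← QuotientGroup.eq, ← smul_eq_mul u, ← MulAction.Quotient.smul_coe]
  simp [h]

section Matrices

variable {k G Ω : Type*} [Field k] [Group G] [MulAction G Ω]

/-- The matrix `m` is invariant under the simultaneous action of `H` on rows and columns. -/
def MatInvariant (H : Subgroup G) (m : Matrix Ω Ω k) : Prop :=
  ∀ h ∈ H, ∀ x y, m (h • x) (h • y) = m x y

/-- The relative trace of a matrix from `H` to `G`. -/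
noncomputable def matTrace [Finite G] (H : Subgroup G) (m : Matrix Ω Ω k) : Matrix Ω Ω k :=
  fun x y => cosetSum H fun g => m (g⁻¹ • x) (g⁻¹ • y)

theorem MatInvariant.rightInvariant {H : Subgroup G} {m : Matrix Ω Ω k} (hm : MatInvariant H m)
    (x y : Ω) : RightInvariant H fun g => m (g⁻¹ • x) (g⁻¹ • y) := by
  intro g h hh
  simp only [mul_inv_rev, mul_smul]
  exact hm _ (inv_mem hh) _ _

theorem matTrace_invariant [Finite G] {H : Subgroup G} {m : Matrix Ω Ω k} (hm : MatInvariant H m) :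
    MatInvariant (⊤ : Subgroup G) (matTrace H m) := by
  intro h _ x y
  unfold matTrace
  rw [← cosetSum_mul_left (hm.rightInvariant _ _) h]
  refine cosetSum_congr fun g => ?_
  simp [mul_smul]

theorem MatInvariant.mul [Fintype Ω] {H : Subgroup G} {m n : Matrix Ω Ω k} (hm : MatInvariant H m)
    (hn : MatInvariant H n) : MatInvariant H (m * n) := by
  intro h hh x y
  rw [Matrix.mul_apply, Matrix.mul_apply]
  symm
  refine Fintype.sum_equiv (MulAction.toPerm h) _ _ fun z => ?_
  simp [hm h hh, hn h hh]

theorem MatInvariant.mono {H K : Subgroup G} (hHK : H ≤ K) {m : Matrix Ω Ω k}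
    (hm : MatInvariant K m) : MatInvariant H m :=
  fun h hh => hm h (hHK hh)

theorem mul_matTrace [Finite G] [Fintype Ω] {H : Subgroup G} {m n : Matrix Ω Ω k}
    (hm : MatInvariant (⊤ : Subgroup G) m) : m * matTrace H n = matTrace H (m * n) := by
  classical
  have := Fintype.ofFinite (G ⧸ H)
  ext x y
  simp only [Matrix.mul_apply, matTrace, cosetSum_eq, Finset.mul_sum]
  rw [Finset.sum_comm]
  refine Finset.sum_congr rfl fun q _ => ?_
  refine Fintype.sum_equiv (MulAction.toPerm q.out⁻¹) _ _ fun z => ?_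
  simp [hm q.out⁻¹ trivial]

section Brauer

variable {p : ℕ} [Fact p.Prime] [CharP k p]

/-- Restriction to the fixed points of a `p`-group is multiplicative on invariant matrices. -/
theorem mul_apply_fixedPoints [Finite G] [Fintype Ω] {Q : Subgroup G} (hQ : IsPGroup p Q)
    {X : Set Ω} [Fintype X] (hX : X = MulAction.fixedPoints Q Ω) {m n : Matrix Ω Ω k}
    (hm : MatInvariant Q m) (hn : MatInvariant Q n) (x y : X) :
    (m * n) x y = ∑ z : X, m x z * n z y := by
  classical
  have hx : ∀ (x : X) (u : Q), (u : G) • (x : Ω) = x := fun x u => by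
    have : ∀ z ∈ X, (u : G) • z = z := fun z hz => by
      rw [hX] at hz
      exact hz u
    exact this x x.2
  -- The intermediate points outside `X` contribute zero: `Q` has no fixed points there, and the
  -- summand is constant on `Q`-orbits.
  have h0 : ∑ z : Ω, (if z ∈ X then 0 else m x z * n z y) = 0 := by
    refine sum_eq_zero_of_isPGroup (Q := Q) hQ _ (fun u z => ?_) fun z hz => ?_
    · have h1 : u • z ∈ X ↔ z ∈ X := by
        have : ∀ (u : Q) (z : Ω), z ∈ X → u • z ∈ X := by
          intro u z hz
          have h2 := hx ⟨z, hz⟩ u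
          simp only at h2
          rw [Subgroup.smul_def, h2]
          exact hz
        refine ⟨fun h => ?_, this u z⟩
        simpa using this u⁻¹ _ h
      simp only [h1]
      split_ifs
      · rfl
      · have h2 := hm u u.2 x z
        have h3 := hn u u.2 z y
        rw [hx] at h2 h3
        rw [Subgroup.smul_def, h2, h3]
    · rw [if_pos]
      rw [hX]
      exact hz
  rw [Matrix.mul_apply, ← add_zero (∑ z : X, _), ← h0]
  have h1 : ∑ z : X, m x z * n z y = ∑ z : Ω, if z ∈ X then m x z * n z y else 0 := by
    rw [← Finset.sum_filter]
    symm
    refine Finset.sum_subtype _ (fun z => by simp) _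
  rw [h1, ← Finset.sum_add_distrib]
  refine Finset.sum_congr rfl fun z _ => ?_
  split_ifs <;> simp

/-- Since `x` and `y` are fixed by `Q`, the terms are constant on the `Q`-orbits of `G/R`. A fixed
coset would put a conjugate of `Q` inside `R`. -/
theorem matTrace_apply_eq_zero [Finite G] {Q R : Subgroup G} (hQ : IsPGroup p Q)
    (hR : ∀ g : G, ¬ ∀ u ∈ Q, g⁻¹ * u * g ∈ R) {m : Matrix Ω Ω k} (hm : MatInvariant R m) {x y : Ω}
    (hx : x ∈ MulAction.fixedPoints Q Ω) (hy : y ∈ MulAction.fixedPoints Q Ω) :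
    matTrace R m x y = 0 := by
  classical
  have := Fintype.ofFinite (G ⧸ R)
  have hinv := hm.rightInvariant x y
  unfold matTrace
  rw [cosetSum_eq]
  refine sum_eq_zero_of_isPGroup (Q := Q) hQ _ (fun u q => ?_) fun q hq => ?_
  · induction q using QuotientGroup.induction_on with | H g => ?_
    have h1 : u • (g : G ⧸ R) = ((u * g : G) : G ⧸ R) := rfl
    rw [h1, hinv.apply_out, hinv.apply_out]
    simp only [mul_inv_rev, mul_smul]
    congr 1
    · exact congrArg _ (hx u⁻¹)
    · exact congrArg _ (hy u⁻¹)
  · exfalso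
    exact hR q.out fun u hu => inv_mul_out_mem (hq ⟨u, hu⟩)

end Brauer

end Matrices

/-- The permutations of `X` that are induced by elements of `G`. -/
def inducedPerms (G : Type*) [Group G] {Ω : Type*} [MulAction G Ω] (X : Set Ω) :
    Subgroup (Equiv.Perm X) where
  carrier := {γ | ∃ g : G, ∀ x : X, g • (x : Ω) = γ x}
  one_mem' := ⟨1, fun x => by simp⟩
  mul_mem' := by
    rintro γ δ ⟨g, hg⟩ ⟨h, hh⟩
    exact ⟨g * h, fun x => by rw [mul_smul, hh, hg]; rfl⟩
  inv_mem' := by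
    rintro γ ⟨g, hg⟩
    refine ⟨g⁻¹, fun x => ?_⟩
    rw [inv_smul_eq_iff, hg]
    simp

open scoped Classical in
/-- Some matrix summed over the permutation group `Γ` is a nonzero idempotent; this says that the
permutation module `kX` of `Γ` has a nonzero projective summand. -/
def HasProjectiveIdempotent (k : Type*) [Field k] {X : Type*} [Finite X]
    (Γ : Subgroup (Equiv.Perm X)) : Prop :=
  haveI := Fintype.ofFinite X
  ∃ b e : X → X → k, (∀ x y, e x y = ∑ γ : Γ, b (γ.1 x) (γ.1 y)) ∧
    (∀ x y, ∑ z, e x z * e z y = e x y) ∧ ∃ x y, e x y ≠ 0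

theorem hasProjectiveIdempotent_iff {k : Type*} [Field k] {X : Type*} [Fintype X]
    {Γ : Subgroup (Equiv.Perm X)} [Fintype Γ] : HasProjectiveIdempotent k Γ ↔
    ∃ b e : X → X → k, (∀ x y, e x y = ∑ γ : Γ, b (γ.1 x) (γ.1 y)) ∧
      (∀ x y, ∑ z, e x z * e z y = e x y) ∧ ∃ x y, e x y ≠ 0 := by
  unfold HasProjectiveIdempotent
  congr!

section BrauerTrace

variable {k G Ω : Type*} [Field k] [Group G] [MulAction G Ω] {p : ℕ} [Fact p.Prime] [CharP k p]

/-- The restriction of a relative trace from `Q` to the fixed points of the `p`-group `Q`. -/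
theorem matTrace_apply_fixedPoints [Finite G] {Q : Subgroup G} (hQ : IsPGroup p Q)
    {X : Set Ω} [Finite X] (hX : X = MulAction.fixedPoints Q Ω) [Fintype (inducedPerms G X)]
    {m : Matrix Ω Ω k} (hm : MatInvariant Q m) (x y : X) :
    matTrace Q m x y = ∑ γ : inducedPerms G X,
      (Q.relIndex (fixingSubgroup G X) : k) * m (γ.1 x : X) (γ.1 y : X) := by
  classical
  have hx : ∀ x ∈ X, ∀ u ∈ Q, (u : G) • (x : Ω) = x := fun x hx u hu => by
    rw [hX] at hx
    exact hx ⟨u, hu⟩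
  set S := fixingSubgroup G X with hSdef
  have hQS : Q ≤ S := fun u hu => (mem_fixingSubgroup_iff G).2 fun y hy => hx y hy u hu
  -- `N` is the setwise stabilizer of `X`, since `X` is finite. Only its cosets will survive in the
  -- trace.
  let N : G → Prop := fun g => ∀ x ∈ X, g • x ∈ X
  have hNS : ∀ g, ∀ h ∈ S, N (g * h) ↔ N g := by
    intro g h hh
    refine forall₂_congr fun x hx => ?_
    rw [mul_smul, (mem_fixingSubgroup_iff G).1 hh x hx]
  have hNinv : ∀ g, N g → N g⁻¹ := by
    intro g hg x hx
    have hinj : Function.Injective fun x : X => (⟨g • (x : Ω), hg x x.2⟩ : X) := by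
      intro a b hab
      simpa [Subtype.ext_iff] using hab
    obtain ⟨z, hz⟩ := Finite.surjective_of_injective hinj ⟨x, hx⟩
    have hz' : g • (z : Ω) = x := congrArg Subtype.val hz
    rw [← hz', inv_smul_smul]
    exact z.2
  have hinv := hm.rightInvariant x y
  set F : G → k := fun g => m (g⁻¹ • (x : Ω)) (g⁻¹ • (y : Ω)) with hF
  let F' : G → k := fun g => if N g then F g else 0
  have hF'S : RightInvariant S F' := by
    intro g h hh
    simp only [F', hNS g h hh]
    split_ifs with hg
    · simp only [F, mul_inv_rev, mul_smul]
      rw [(mem_fixingSubgroup_iff G).1 (inv_mem hh) _ (hNinv g hg x x.2),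
        (mem_fixingSubgroup_iff G).1 (inv_mem hh) _ (hNinv g hg y y.2)]
    · rfl
  -- If `Q` fixes the coset `gQ`, then `g⁻¹Qg ≤ Q`, so `g` carries `X = Fix Q` into itself. Hence
  -- the terms dropped in `F'` form a function without support on the fixed cosets, and its sum
  -- vanishes.
  have h1 : matTrace Q m x y = cosetSum Q F' := by
    have := Fintype.ofFinite (G ⧸ Q)
    have hF'Q : RightInvariant Q F' := fun g h hh => hF'S g h (hQS hh)
    change cosetSum Q F = _
    rw [← sub_eq_zero, cosetSum_eq, cosetSum_eq, ← Finset.sum_sub_distrib]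
    refine sum_eq_zero_of_isPGroup (Q := Q) hQ _ (fun u q => ?_) fun q hq => ?_
    · induction q using QuotientGroup.induction_on with | H g => ?_
      have h1 : u • (g : G ⧸ Q) = ((u * g : G) : G ⧸ Q) := rfl
      have h2 : N (u * g) ↔ N g := by
        have : ∀ (u : Q) g, N g → N (u * g) := fun u g hg x hx' => by
          rw [mul_smul, hx _ (hg x hx') u u.2]
          exact hg x hx'
        refine ⟨fun h => ?_, this u g⟩
        simpa using this u⁻¹ _ h
      rw [h1, hinv.apply_out, hinv.apply_out, hF'Q.apply_out, hF'Q.apply_out]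
      have h3 : F (u * g) = F g := by
        simp only [hF, mul_inv_rev, mul_smul]
        rw [hx x x.2 _ (inv_mem u.2), hx y y.2 _ (inv_mem u.2)]
      simp only [F', h2, h3]
    · have : N q.out := by
        intro x hx'
        rw [hX]
        intro u
        have h4 := hx x hx' _ (inv_mul_out_mem (hq u))
        rwa [mul_smul, mul_smul, inv_smul_eq_iff] at h4
      simp [F', this]
  rw [h1, cosetSum_eq_relIndex_nsmul hQS hF'S]
  have := Fintype.ofFinite (G ⧸ S)
  rw [cosetSum_eq]
  symm
  -- It is the inverse of the representative that induces `γ`, because the trace evaluates `m` at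
  -- `g⁻¹`. The cosets `c γ · S` are exactly the cosets of `S` inside `N`.
  have hc : ∀ γ : inducedPerms G X, ∃ g : G, ∀ x : X, g⁻¹ • (x : Ω) = γ.1 x := by
    rintro ⟨γ, g, hg⟩
    exact ⟨g⁻¹, by simpa using hg⟩
  choose c hc using hc
  have hcN : ∀ γ, N (c γ) := by
    intro γ x hx
    have := hNinv (c γ)⁻¹ (fun x hx => by rw [hc γ ⟨x, hx⟩]; exact Subtype.property _)
    simpa using this x hx
  refine Fintype.sum_of_injective (fun γ => ((c γ : G) : G ⧸ S)) ?_ _ _ ?_ ?_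
  · intro γ δ h
    have h1 := (mem_fixingSubgroup_iff G).1 (QuotientGroup.eq.1 h)
    ext x
    rw [← hc, ← hc]
    have h3 := h1 _ (hNinv _ (hcN δ) x x.2)
    simpa [mul_smul] using h3
  · intro q hq
    have : ¬ N q.out := by
      intro hN
      apply hq
      have hN' := hNinv _ hN
      have hinj : Function.Injective fun x : X => (⟨q.out⁻¹ • (x : Ω), hN' x x.2⟩ : X) := by
        intro a b hab
        simpa [Subtype.ext_iff] using hab
      let γ : inducedPerms G X := ⟨Equiv.ofBijective _
        ((Finite.injective_iff_bijective).1 hinj), q.out⁻¹, fun x => rfl⟩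
      refine ⟨γ, ?_⟩
      have h3 : (q.out : G ⧸ S) = q := by simp
      rw [← h3]
      refine QuotientGroup.eq.2 ((mem_fixingSubgroup_iff G).2 fun z hz => ?_)
      have h4 := hc γ ⟨_, hN z hz⟩
      rw [mul_smul, h4]
      simp [γ]
    simp [F', this]
  · intro γ
    have h2 : F' (c γ : G ⧸ S).out = F' (c γ) := hF'S.apply_out _
    rw [h2, nsmul_eq_mul]
    simp only [F', hcN, if_true, F, hc]

end BrauerTrace

end FixedPointSets

/-! ### Endomorphisms of permutation modules as matrices, and Fitting's lemma. -/

namespace FixedPointSets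

open scoped MonoidAlgebra

section PermutationModules

variable {k G Ω : Type*} [Field k] [Group G] [MulAction G Ω] [Fintype Ω] [DecidableEq Ω]

/-- The matrix of an endomorphism of a permutation module. -/
noncomputable def toMat : Module.End k k[Ω] ≃ₐ[k] Matrix Ω Ω k :=
  LinearMap.toMatrixAlgEquiv (Module.Basis.ofRepr (MonoidAlgebra.coeffLinearEquiv k))

theorem toMat_apply (f : Module.End k k[Ω]) (x y : Ω) :
    toMat f x y = (f (MonoidAlgebra.single y 1)).coeff x := by
  simp [toMat, LinearMap.toMatrixAlgEquiv_apply]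

theorem toMat_conj (f : Module.End k k[Ω]) (g : G) (x y : Ω) :
    toMat (Representation.ofMulAction k G Ω g ∘ₗ f ∘ₗ Representation.ofMulAction k G Ω g⁻¹) x y =
      toMat f (g⁻¹ • x) (g⁻¹ • y) := by
  simp [toMat_apply, Representation.coeff_ofMulAction]

theorem commutes_iff_toMat (f : Module.End k k[Ω]) (g : G) :
    (∀ v, f (Representation.ofMulAction k G Ω g v) = Representation.ofMulAction k G Ω g (f v)) ↔
      ∀ x y, toMat f (g • x) (g • y) = toMat f x y := by
  constructor
  · intro h x y
    have h1 : Representation.ofMulAction k G Ω g ∘ₗ f ∘ₗ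
        Representation.ofMulAction k G Ω g⁻¹ = f := by
      refine LinearMap.ext fun v => ?_
      rw [LinearMap.comp_apply, LinearMap.comp_apply, ← h, Representation.self_inv_apply]
    have := toMat_conj f g (g • x) (g • y)
    rw [inv_smul_smul, inv_smul_smul, h1] at this
    exact this
  · intro h
    have : f = Representation.ofMulAction k G Ω g ∘ₗ f ∘ₗ
        Representation.ofMulAction k G Ω g⁻¹ := by
      apply toMat.injective
      ext x y
      rw [toMat_conj, ← h (g⁻¹ • x), smul_inv_smul, smul_inv_smul]
    intro v
    conv_lhs => rw [this]
    rw [LinearMap.comp_apply, LinearMap.comp_apply, Representation.inv_self_apply]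

theorem isRelTrace_iff_toMat [Finite G] (H : Subgroup G) (f : Module.End k k[Ω]) :
    IsRelTrace (Representation.ofMulAction k G Ω) H f ↔
      ∃ m : Matrix Ω Ω k, MatInvariant H m ∧ toMat f = matTrace H m := by
  have key : ∀ θ : Module.End k k[Ω], toMat (cosetSum H fun g =>
      Representation.ofMulAction k G Ω g ∘ₗ θ ∘ₗ Representation.ofMulAction k G Ω g⁻¹) =
      matTrace H (toMat θ) := by
    intro θ
    ext x y
    let φ : Module.End k k[Ω] →+ k :=
      { toFun := fun f => toMat f x y
        map_zero' := by simp
        map_add' := by simp }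
    change φ _ = _
    rw [map_cosetSum]
    exact cosetSum_congr fun g => toMat_conj _ _ _ _
  constructor
  · rintro ⟨θ, hθ, rfl⟩
    exact ⟨toMat θ, fun h hh => (commutes_iff_toMat θ h).1 (hθ h hh), key θ⟩
  · rintro ⟨m, hm, hf⟩
    obtain ⟨θ, rfl⟩ := toMat.surjective m
    refine ⟨θ, fun h hh => (commutes_iff_toMat θ h).2 (hm h hh), ?_⟩
    apply toMat.injective
    rw [hf, key]

/-- The part of an invariant matrix on a single orbit is a relative trace from the stabilizer of
an element of the orbit. -/
theorem matTrace_orbit [Finite G] {Q : Subgroup G} {m : Matrix Ω Ω k} (hm : MatInvariant Q m)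
    (z : Ω × Ω) [∀ w, Decidable (w ∈ MulAction.orbit Q z)] :
    matTrace Q (fun x y => if (x, y) ∈ MulAction.orbit Q z then m x y else 0) =
      matTrace ((MulAction.stabilizer Q z).map Q.subtype)
        (fun x y => if (x, y) = z then m x y else 0) := by
  classical
  set R := (MulAction.stabilizer Q z).map Q.subtype with hR
  have hRQ : R ≤ Q := Subgroup.map_subtype_le _
  have hmem : ∀ u : Q, u ∈ R.subgroupOf Q ↔ u • z = z := by
    intro u
    rw [hR, Subgroup.mem_subgroupOf]
    simp [MulAction.mem_stabilizer_iff, Subgroup.smul_def]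
  have hinv : MatInvariant R (fun x y => if (x, y) = z then m x y else 0) := by
    intro h hh x y
    have h1 : h • z = z := (hmem ⟨h, hRQ hh⟩).1 (Subgroup.mem_subgroupOf.2 hh)
    have h2 : (h • x, h • y) = z ↔ (x, y) = z := by
      rw [← Prod.smul_mk]
      nth_rw 1 [← h1]
      exact (MulAction.injective h).eq_iff
    simp only [h2, hm h (hRQ hh)]
  ext x y
  unfold matTrace
  rw [cosetSum_eq_cosetSum hRQ (hinv.rightInvariant x y)]
  refine cosetSum_congr fun g => ?_
  have := Fintype.ofFinite (Q ⧸ R.subgroupOf Q)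
  rw [cosetSum_eq]
  have h1 : ∀ u : Q, ((g * (u : G))⁻¹ • x, (g * (u : G))⁻¹ • y) = z ↔
      (g⁻¹ • x, g⁻¹ • y) = u • z := by
    intro u
    rw [← inv_smul_eq_iff, Subgroup.smul_def]
    simp [mul_smul]
  simp only [h1]
  by_cases h : (g⁻¹ • x, g⁻¹ • y) ∈ MulAction.orbit Q z
  · rw [if_pos h]
    obtain ⟨u, hu⟩ := h
    simp only at hu
    have h2 : (u : Q ⧸ R.subgroupOf Q).out • z = u • z := by
      have := (hmem _).1 (QuotientGroup.eq.1
        (show (u : Q ⧸ R.subgroupOf Q) = ((u : Q ⧸ R.subgroupOf Q).out : Q) by simp))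
      rw [mul_smul, inv_smul_eq_iff] at this
      exact this
    -- Cosets of the stabilizer correspond to points of the orbit, so exactly one of them matches
    -- the given pair.
    rw [Fintype.sum_eq_single (u : Q ⧸ R.subgroupOf Q)]
    · rw [h2, if_pos hu.symm]
      simp only [mul_inv_rev, mul_smul]
      exact (hm _ (inv_mem (Subtype.property _)) _ _).symm
    · intro q hq
      rw [if_neg]
      intro h3
      apply hq
      have : ((q.out : Q) : Q ⧸ R.subgroupOf Q) = u := by
        refine QuotientGroup.eq.2 ((hmem _).2 ?_)
        rw [mul_smul, inv_smul_eq_iff, hu, h3]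
      simpa using this
  · rw [if_neg h]
    symm
    refine Finset.sum_eq_zero fun q _ => if_neg fun h3 => h ?_
    exact ⟨_, h3.symm⟩

end PermutationModules

section Indecomposable

variable {k G V : Type*} [Field k] [Group G] [AddCommGroup V] [Module k V]

/-- Fitting's lemma: for large `n` the kernel and range of `f ^ n` are complementary
subrepresentations, so one of them is zero. -/
theorem IsIndecomposable.isNilpotent_or_bijective {ρ : Representation k G V}
    (hρ : IsIndecomposable ρ) [FiniteDimensional k V] {f : Module.End k V}
    (hf : ∀ g v, f (ρ g v) = ρ g (f v)) : IsNilpotent f ∨ Function.Bijective f := by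
  obtain ⟨n, hn, h0⟩ : ∃ n, IsCompl (LinearMap.ker (f ^ n)) (LinearMap.range (f ^ n)) ∧ n ≠ 0 := by
    have := f.eventually_isCompl_ker_pow_range_pow
    obtain ⟨n, hn⟩ := Filter.eventually_atTop.1 this
    exact ⟨n + 1, hn _ (by simp), by simp⟩
  have hfn : ∀ g v, (f ^ n) (ρ g v) = ρ g ((f ^ n) v) := by
    intro g
    have h1 : Commute f (ρ g) := LinearMap.ext (hf g)
    exact fun v => LinearMap.congr_fun (h1.pow_left n) v
  rcases hρ.2 ⟨LinearMap.ker (f ^ n), fun g v hv => by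
      rw [LinearMap.mem_ker] at hv ⊢
      rw [hfn, hv, map_zero]⟩
    ⟨LinearMap.range (f ^ n), by
      rintro g _ ⟨v, rfl⟩
      exact ⟨ρ g v, hfn g v⟩⟩ hn with h | h
  · right
    have h1 : Function.Injective (f ^ n) := LinearMap.ker_eq_bot.1 h
    have h2 : Function.Injective f := by
      obtain ⟨m, rfl⟩ := Nat.exists_eq_succ_of_ne_zero h0
      rw [Nat.succ_eq_add_one, pow_succ] at h1
      exact Function.Injective.of_comp h1
    exact ⟨h2, LinearMap.injective_iff_surjective.1 h2⟩
  · left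
    exact ⟨n, LinearMap.range_eq_bot.1 h⟩

/-- This is locality of the endomorphism ring, in the form of Rosenberg's lemma. After dividing by
the invertible sum, either the first term is invertible, or it is nilpotent and the rest of the sum
is invertible. -/
theorem IsIndecomposable.exists_bijective_of_sum {ρ : Representation k G V}
    (hρ : IsIndecomposable ρ) [FiniteDimensional k V] {ι : Type*} (s : Finset ι)
    (f : ι → Module.End k V) (hf : ∀ j g v, f j (ρ g v) = ρ g (f j v))
    (h : Function.Bijective ⇑(∑ j ∈ s, f j : Module.End k V)) : ∃ j ∈ s, Function.Bijective (f j) := by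
  classical
  have := hρ.1
  induction s using Finset.induction_on with
  | empty =>
    obtain ⟨v, hv⟩ := exists_ne (0 : V)
    exact absurd (h.1 (a₁ := v) (a₂ := 0) (by simp)) hv
  | insert a s ha ih =>
    rw [Finset.sum_insert ha] at h
    set u := f a + ∑ j ∈ s, f j with hu
    let e := LinearEquiv.ofBijective u h
    have hs : ∀ g v, (∑ j ∈ s, f j) (ρ g v) = ρ g ((∑ j ∈ s, f j) v) := by
      intro g v
      simp [LinearMap.sum_apply, hf]
    have hug : ∀ g v, u (ρ g v) = ρ g (u v) := fun g v => by simp [hu, hf, hs]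
    have he : ∀ g v, e.symm (ρ g v) = ρ g (e.symm v) := by
      intro g v
      rw [LinearEquiv.symm_apply_eq]
      change _ = u _
      rw [hug]
      exact congrArg _ (e.apply_symm_apply v).symm
    have h1 : (e.symm.toLinearMap * f a : Module.End k V) +
        e.symm.toLinearMap * (∑ j ∈ s, f j) = 1 := by
      rw [← mul_add, ← hu]
      ext v
      exact e.symm_apply_apply v
    rcases hρ.isNilpotent_or_bijective (f := e.symm.toLinearMap * f a)
      (fun g v => by simp [hf, he]) with h2 | h2
    · have h3 : Function.Bijective (e.symm.toLinearMap * (∑ j ∈ s, f j) : Module.End k V) := by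
        rw [← Module.End.isUnit_iff, eq_sub_iff_add_eq'.2 h1]
        exact h2.isUnit_one_sub
      have h4 : Function.Bijective ⇑(∑ j ∈ s, f j : Module.End k V) :=
        (Function.Bijective.of_comp_iff' e.symm.bijective _).1 h3
      obtain ⟨j, hj, hj'⟩ := ih h4
      exact ⟨j, Finset.mem_insert_of_mem hj, hj'⟩
    · exact ⟨a, Finset.mem_insert_self _ _,
        (Function.Bijective.of_comp_iff' e.symm.bijective _).1 h2⟩

end Indecomposable

end FixedPointSets

/-! ### From a vertex to a projective idempotent on its fixed points. -/

namespace FixedPointSets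

open scoped MonoidAlgebra

/-- Each pair of points lies in one `Q`-orbit. With `matTrace_orbit` this splits a trace from `Q` of
a `Q`-invariant matrix into traces from stabilizers of pairs. -/
theorem matTrace_eq_sum_orbits {k G Ω : Type*} [Field k] [Group G] [MulAction G Ω] [Fintype Ω]
    [Finite G] {Q : Subgroup G} (m : Matrix Ω Ω k) [Fintype (MulAction.orbitRel.Quotient Q (Ω × Ω))]
    [∀ z w : Ω × Ω, Decidable (w ∈ MulAction.orbit Q z)] :
    matTrace Q m = ∑ o : MulAction.orbitRel.Quotient Q (Ω × Ω),
      matTrace Q (fun x y => if (x, y) ∈ MulAction.orbit Q o.out then m x y else 0) := by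
  classical
  ext x y
  rw [Matrix.sum_apply]
  have := Fintype.ofFinite (G ⧸ Q)
  simp only [matTrace, cosetSum_eq]
  rw [Finset.sum_comm]
  refine Finset.sum_congr rfl fun q _ => ?_
  set z : Ω × Ω := (q.out⁻¹ • x, q.out⁻¹ • y) with hz
  have hout : ∀ o : MulAction.orbitRel.Quotient Q (Ω × Ω), z ∈ MulAction.orbit Q o.out ↔
      Quotient.mk'' z = o := by
    intro o
    rw [← MulAction.orbitRel_apply, ← Quotient.eq'' (s₁ := MulAction.orbitRel Q (Ω × Ω)),
      Quotient.out_eq']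
  simp only [hout]
  rw [Finset.sum_ite_eq]
  simp

section

variable {k : Type*} [Field k] {p : ℕ} [Fact p.Prime] [CharP k p]

theorem not_conj_le_of_lt {G : Type*} [Group G] [Finite G] {Q R : Subgroup G} (h : R < Q)
    (g : G) : ¬ ∀ u ∈ Q, g⁻¹ * u * g ∈ R := by
  intro hg
  have h1 : Nat.card Q ≤ Nat.card R := by
    refine Nat.card_le_card_of_injective (fun u : Q => (⟨g⁻¹ * u * g, hg u u.2⟩ : R)) ?_
    intro a b hab
    exact Subtype.ext (mul_left_cancel (mul_right_cancel (congrArg Subtype.val hab)))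
  exact h.ne (Subgroup.eq_of_le_of_card_ge h.le h1)

/-- The vertices of an indecomposable representation are `p`-groups. -/
theorem IsVertex.isPGroup {G : Type*} [Group G] [Finite G] {V : Type*} [AddCommGroup V]
    [Module k V] {ρ : Representation k G V} {Q : Subgroup G} (hQ : IsVertex ρ Q) :
    IsPGroup p Q := by
  obtain ⟨P⟩ : Nonempty (Sylow p Q) := inferInstance
  have hle : P.map Q.subtype ≤ Q := Subgroup.map_subtype_le _
  -- A Sylow subgroup of `Q` has index prime to `p`, so the identity is already a trace from it;
  -- minimality of `Q` then leaves no room.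
  have h1 : ((P.map Q.subtype).relIndex Q : k) ≠ 0 := by
    have h2 : (P.map Q.subtype).relIndex Q = P.index := by
      rw [Subgroup.relIndex, ← Subgroup.comap_subtype,
        Subgroup.comap_map_eq_self_of_injective Q.subtype_injective]
    rw [h2, Ne, CharP.cast_eq_zero_iff k p]
    exact P.not_dvd_index
  have h2 := hQ.2 ((isComponentOfInduced_iff ρ _).2
    (((isComponentOfInduced_iff ρ Q).1 hQ.1).of_le hle h1)) hle
  exact (P.2.map Q.subtype).to_le h2

/-- A vertex `Q` of a summand of a permutation module is a Sylow `p`-subgroup of the pointwise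
stabilizer of `Fix Q`, and the permutation module on `Fix Q` has a projective summand. -/
theorem IsFixedPointSubset.exists_vertex {G : Type*} [Group G] [Finite G] {Ω : Type} [Finite Ω]
    [MulAction G Ω] {X : Set Ω} (h : IsFixedPointSubset k G X) :
    ∃ Q : Subgroup G, IsPGroup p Q ∧ X = MulAction.fixedPoints Q Ω ∧
      ¬ p ∣ Q.relIndex (fixingSubgroup G X) ∧ HasProjectiveIdempotent k (inducedPerms G X) := by
  classical
  have := Fintype.ofFinite Ω
  have := Fintype.ofFinite X
  obtain ⟨V, _, _, ρ, hρ, ⟨i, r, hir⟩, Q, hQ, hX⟩ := h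
  have hQp : IsPGroup p Q := hQ.isPGroup
  have hi : ∀ g v, i (ρ g v) = Representation.ofMulAction k G Ω g (i v) := i.isIntertwining
  have hr : ∀ g v, r (Representation.ofMulAction k G Ω g v) = ρ g (r v) := r.isIntertwining
  have hfin : FiniteDimensional k k[Ω] :=
    Module.Finite.equiv (MonoidAlgebra.coeffLinearEquiv k).symm
  have hV : FiniteDimensional k V :=
    FiniteDimensional.of_injective i.toLinearMap (fun a b hab => by
      rw [← hir a, ← hir b]
      exact congrArg _ hab)
  let e : Module.End k k[Ω] := i.toLinearMap ∘ₗ r.toLinearMap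
  have hid := (isComponentOfInduced_iff ρ Q).1 hQ.1
  have heQ : IsRelTrace (Representation.ofMulAction k G Ω) Q e :=
    hid.comp i.toLinearMap r.toLinearMap hi hr
  obtain ⟨m, hm, hem⟩ := (isRelTrace_iff_toMat Q e).1 heQ
  have hee : e * e = e := by
    refine LinearMap.ext fun v => ?_
    change i (r (i (r v))) = i (r v)
    rw [hir]
  have hE : MatInvariant (⊤ : Subgroup G) (toMat e) := by
    rw [hem]
    exact matTrace_invariant hm
  have hEE : toMat e * toMat e = toMat e := by rw [← map_mul, hee]
  -- Otherwise `e = e * e` is the trace of `n = e * m`, which vanishes on `X × X`. Split this trace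
  -- by orbits of `Q` on pairs.
  have hne : ∃ x y : X, toMat e x y ≠ 0 := by
    by_contra! h0
    set n := toMat e * m with hn
    have hnQ : MatInvariant Q n := (hE.mono le_top).mul hm
    have hn0 : ∀ x ∈ X, ∀ y ∈ X, n x y = 0 := by
      intro x hx y hy
      rw [hn, mul_apply_fixedPoints hQp hX (hE.mono le_top) hm ⟨x, hx⟩ ⟨y, hy⟩]
      exact Finset.sum_eq_zero fun z _ => by rw [h0, zero_mul]
    have hen : toMat e = matTrace Q n := by
      rw [hn, ← mul_matTrace hE, ← hem, hEE]
    have := Fintype.ofFinite (MulAction.orbitRel.Quotient Q (Ω × Ω))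
    rw [matTrace_eq_sum_orbits] at hen
    let f : MulAction.orbitRel.Quotient Q (Ω × Ω) → Module.End k k[Ω] := fun o =>
      toMat.symm (matTrace Q
        (fun x y => if (x, y) ∈ MulAction.orbit Q o.out then n x y else 0))
    have hef : e = ∑ o, f o := by
      apply toMat.injective
      rw [hen, map_sum]
      simp [f]
    have hf : ∀ o, IsRelTrace (Representation.ofMulAction k G Ω)
        ((MulAction.stabilizer Q o.out).map Q.subtype) (f o) := by
      intro o
      rw [isRelTrace_iff_toMat]
      refine ⟨fun x y => if (x, y) = o.out then n x y else 0, ?_, ?_⟩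
      · intro h hh x y
        obtain ⟨u, hu, rfl⟩ := hh
        have h1 : ((u : G) • x, (u : G) • y) = o.out ↔ (x, y) = o.out := by
          have h1 : u • o.out = o.out := hu
          rw [← Prod.smul_mk]
          nth_rw 1 [← h1]
          exact (MulAction.injective (u : G)).eq_iff
        simp only [Subgroup.subtype_apply, h1, hnQ u u.2]
      · simp only [f, AlgEquiv.apply_symm_apply]
        exact matTrace_orbit hnQ o.out
    have hfG : ∀ o g v, f o (Representation.ofMulAction k G Ω g v) =
        Representation.ofMulAction k G Ω g (f o v) := by
      intro o g
      rw [commutes_iff_toMat]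
      obtain ⟨m', hm', h⟩ := (isRelTrace_iff_toMat _ _).1 (hf o)
      rw [h]
      exact matTrace_invariant hm' g trivial
    -- Some orbit already gives an automorphism of `V`, so the identity of `V` is a trace from the
    -- stabilizer `R` of a pair. Minimality of `Q` gives `R = Q`, hence the pair lies in `X × X`,
    -- where `n` is zero: a contradiction.
    obtain ⟨o, -, ho⟩ := hρ.exists_bijective_of_sum Finset.univ
      (fun o => r.toLinearMap ∘ₗ f o ∘ₗ i.toLinearMap)
      (fun o g v => by
        change r (f o (i (ρ g v))) = ρ g (r (f o (i v)))
        rw [hi, hfG, hr]) (by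
        convert Function.bijective_id
        ext v
        rw [LinearMap.sum_apply]
        change ∑ o, r (f o (i v)) = v
        rw [← map_sum, ← LinearMap.sum_apply, ← hef]
        change r (i (r (i v))) = v
        rw [hir, hir])
    set R := (MulAction.stabilizer Q o.out).map Q.subtype with hR
    have hRQ : R ≤ Q := Subgroup.map_subtype_le _
    let u := LinearEquiv.ofBijective _ ho
    have hu : ∀ g v, u (ρ g v) = ρ g (u v) := fun g v => by
      change r (f o (i (ρ g v))) = ρ g (r (f o (i v)))
      rw [hi, hfG, hr]
    have h1 := ((hf o).comp (σ := ρ) r.toLinearMap i.toLinearMap hr hi).comp (σ := ρ)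
      u.symm.toLinearMap LinearMap.id (fun g v => by
        change u.symm _ = ρ g (u.symm v)
        rw [LinearEquiv.symm_apply_eq, hu, LinearEquiv.apply_symm_apply]) (fun g v => rfl)
    have h2 : IsRelTrace ρ R LinearMap.id := by
      convert h1
      refine LinearMap.ext fun v => ?_
      exact (u.symm_apply_apply v).symm
    have h3 : Q ≤ R := hQ.2 ((isComponentOfInduced_iff ρ R).2 h2) hRQ
    have h4 : ∀ u : Q, u • o.out = o.out := by
      intro u
      obtain ⟨u', hu', huu'⟩ := h3 u.2
      have : u' = u := Subtype.ext huu'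
      rw [← this]
      exact hu'
    have h5 : f o = 0 := by
      apply toMat.injective
      simp only [f, AlgEquiv.apply_symm_apply, map_zero]
      ext x y
      refine (congrArg (cosetSum Q) (funext fun g => ?_)).trans
        (map_cosetSum (0 : k →+ k) Q (fun _ => 0)).symm
      change (if _ then _ else _) = (0 : k)
      split_ifs with h6
      · obtain ⟨u, hu⟩ := h6
        simp only [h4] at hu
        refine hn0 _ ?_ _ ?_
        · rw [hX]
          exact fun u => congrArg Prod.fst (hu ▸ h4 u)
        · rw [hX]
          exact fun u => congrArg Prod.snd (hu ▸ h4 u)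
      · rfl
    have := hρ.1
    obtain ⟨v, hv⟩ := exists_ne (0 : V)
    refine hv (ho.1 ?_)
    simp [h5]
  have key : ∀ x y : X, toMat e x y = ∑ γ : inducedPerms G X,
      (Q.relIndex (fixingSubgroup G X) : k) * m (γ.1 x : X) (γ.1 y : X) := by
    intro x y
    rw [hem]
    exact matTrace_apply_fixedPoints hQp hX hm x y
  -- The index is a factor of every entry of the restriction of `e`, so it cannot vanish in `k`.
  refine ⟨Q, hQp, hX, fun hdvd => ?_, ?_⟩
  · obtain ⟨x, y, hxy⟩ := hne
    rw [key, (CharP.cast_eq_zero_iff k p _).2 hdvd] at hxy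
    simp at hxy
  · rw [hasProjectiveIdempotent_iff]
    refine ⟨fun x y => (Q.relIndex (fixingSubgroup G X) : k) * m x y, fun x y => toMat e x y, key, fun x y => ?_, hne⟩
    rw [← mul_apply_fixedPoints hQp hX (hE.mono le_top) (hE.mono le_top), hEE]

end

end FixedPointSets

/-! ### From a projective idempotent on fixed points to a vertex. -/

namespace FixedPointSets

open scoped MonoidAlgebra

/-- Fitting idempotents are polynomials without constant term. -/
theorem exists_fitting_idempotent {k A : Type*} [Field k] [Ring A] [Algebra k A]
    [FiniteDimensional k A] (f : A) : ∃ (a : Polynomial k) (n : ℕ),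
      IsIdempotentElem (Polynomial.aeval f a * f ^ n * f) ∧
      (Polynomial.aeval f a * f ^ n * f) * f ^ (n + 1) = f ^ (n + 1) := by
  classical
  have hint : IsIntegral k f := Algebra.IsIntegral.isIntegral f
  obtain ⟨h, hh, hdvd⟩ := Polynomial.exists_eq_pow_rootMultiplicity_mul_and_not_dvd
    (minpoly k f) (minpoly.ne_zero hint) 0
  set n := (minpoly k f).rootMultiplicity 0
  rw [Polynomial.C_0, sub_zero] at hh hdvd
  -- The exponent is `n + 1` and not `n`, so that the idempotent has a factor `f` even when `f` is
  -- invertible. That factor makes it a relative trace whenever `f` is one.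
  have hcop : IsCoprime (Polynomial.X ^ (n + 1)) h :=
    ((Polynomial.irreducible_X.coprime_iff_not_dvd).2 hdvd).pow_left
  obtain ⟨a, b, hab⟩ := hcop
  have h0 : f ^ (n + 1) * Polynomial.aeval f h = 0 := by
    have h1 : Polynomial.aeval f (Polynomial.X * minpoly k f) = 0 := by simp
    rw [hh] at h1
    rw [← h1]
    simp [pow_succ', mul_assoc]
  have h1 : Polynomial.aeval f a * f ^ n * f + Polynomial.aeval f b * Polynomial.aeval f h = 1 := by
    have := congrArg (Polynomial.aeval f) hab
    simpa [pow_succ, mul_assoc] using this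
  have hc : ∀ c : Polynomial k, Commute (f ^ (n + 1)) (Polynomial.aeval f c) := by
    intro c
    simpa using (Commute.all (Polynomial.X ^ (n + 1)) c).map (Polynomial.aeval f)
  have h2 : (Polynomial.aeval f a * f ^ n * f) * (Polynomial.aeval f b * Polynomial.aeval f h) =
      0 := by
    rw [mul_assoc _ _ f, ← pow_succ, mul_assoc, ← mul_assoc (f ^ (n + 1)), (hc b).eq,
      mul_assoc _ (f ^ (n + 1)), h0, mul_zero, mul_zero]
  have h3 : f ^ (n + 1) * (Polynomial.aeval f b * Polynomial.aeval f h) = 0 := by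
    rw [← mul_assoc, (hc b).eq, mul_assoc, h0, mul_zero]
  refine ⟨a, n, ?_, ?_⟩
  · have h4 := congrArg (Polynomial.aeval f a * f ^ n * f * ·) h1
    simp only [mul_add, h2, add_zero, mul_one] at h4
    exact h4
  · have h4 := congrArg (· * f ^ (n + 1)) h1
    simpa only [add_mul, ← ((hc b).mul_right (hc h)).eq, h3, add_zero, one_mul] using h4

section

variable {k G V : Type*} [Field k] [Group G] [AddCommGroup V] [Module k V]

theorem projectionOnto_comm {ρ : Representation k G V} (A B : Subrepresentation ρ)
    (h : IsCompl A.toSubmodule B.toSubmodule) (g : G) (v : V) :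
    (A.toSubmodule.projectionOnto B.toSubmodule h (ρ g v) : V) =
      ρ g (A.toSubmodule.projectionOnto B.toSubmodule h v) := by
  obtain ⟨a, b, rfl⟩ : ∃ (a : A.toSubmodule) (b : B.toSubmodule), (a : V) + b = v := by
    have : v ∈ A.toSubmodule ⊔ B.toSubmodule := by simp [h.sup_eq_top]
    obtain ⟨a, ha, b, hb, h⟩ := Submodule.mem_sup.1 this
    exact ⟨⟨a, ha⟩, ⟨b, hb⟩, h⟩
  have ha := A.toSubmodule.projectionOnto_apply_left h ⟨_, A.apply_mem_toSubmodule g a.2⟩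
  have hb := A.toSubmodule.projectionOnto_apply_right h ⟨_, B.apply_mem_toSubmodule g b.2⟩
  simp only at ha hb
  simp [map_add, ha, hb]

end

section

variable {k : Type*} [Field k] {p : ℕ} [Fact p.Prime] [CharP k p]

/-- Restriction to `X` is multiplicative and the restriction of `M` is idempotent, so all positive
powers of `M` restrict to the same matrix. -/
theorem toMat_pow_apply {G : Type*} [Group G] [Finite G] {Ω : Type*} [Fintype Ω] [DecidableEq Ω]
    [MulAction G Ω] {X : Set Ω} [Fintype X] {Q : Subgroup G} (hQ : IsPGroup p Q)
    (hX : X = MulAction.fixedPoints Q Ω) {M : Matrix Ω Ω k} (hM : MatInvariant Q M)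
    (hMM : ∀ x y : X, ∑ z : X, M x z * M z y = M x y) (n : ℕ) :
    MatInvariant Q (M ^ (n + 1)) ∧ ∀ x y : X, (M ^ (n + 1)) x y = M x y := by
  induction n with
  | zero => simpa using hM
  | succ n ih =>
    rw [pow_succ]
    refine ⟨ih.1.mul hM, fun x y => ?_⟩
    rw [mul_apply_fixedPoints hQ hX ih.1 hM, ← hMM]
    simp only [ih.2]

/-- A criterion for fixed point sets. -/
theorem isFixedPointSubset_of_hasProjectiveIdempotent {G : Type*} [Group G] [Finite G] {Ω : Type}
    [Finite Ω] [MulAction G Ω] {X : Set Ω} {Q : Subgroup G} (hQ : IsPGroup p Q)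
    (hX : X = MulAction.fixedPoints Q Ω) (hQX : ¬ p ∣ Q.relIndex (fixingSubgroup G X))
    (hP : HasProjectiveIdempotent k (inducedPerms G X)) : IsFixedPointSubset k G X := by
  classical
  have := Fintype.ofFinite Ω
  have := Fintype.ofFinite X
  obtain ⟨b, e, hbe, hee, x₀, y₀, he0⟩ := hasProjectiveIdempotent_iff.1 hP
  have hfin : FiniteDimensional k k[Ω] :=
    Module.Finite.equiv (MonoidAlgebra.coeffLinearEquiv k).symm
  have hc0 : (Q.relIndex (fixingSubgroup G X) : k) ≠ 0 := by
    rwa [Ne, CharP.cast_eq_zero_iff k p]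
  set c := (Q.relIndex (fixingSubgroup G X) : k) with hc
  set σ := Representation.ofMulAction k G Ω with hσ
  have hQfix : ∀ u ∈ Q, ∀ x ∈ X, u • x = x := fun u hu x hx => by
    rw [hX] at hx
    exact hx ⟨u, hu⟩
  have hQmem : ∀ u ∈ Q, ∀ x, u • x ∈ X ↔ x ∈ X := by
    intro u hu x
    refine ⟨fun h => ?_, fun h => by rwa [hQfix u hu x h]⟩
    have := hQfix u⁻¹ (inv_mem hu) _ h
    rw [inv_smul_smul] at this
    rwa [this]
  -- This is `b` extended by zero. The factor `c⁻¹` cancels the index in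
  -- `matTrace_apply_fixedPoints`, so the trace of `m` restricts to `e`.
  let m : Matrix Ω Ω k := fun x y =>
    if h : x ∈ X ∧ y ∈ X then c⁻¹ * b ⟨x, h.1⟩ ⟨y, h.2⟩ else 0
  have hm : MatInvariant Q m := by
    intro u hu x y
    by_cases h : x ∈ X ∧ y ∈ X
    · rw [hQfix u hu x h.1, hQfix u hu y h.2]
    · simp only [m, hQmem u hu, h, dif_neg, not_false_eq_true]
  set F := matTrace Q m with hF
  have hFe : ∀ x y : X, F x y = e x y := by
    intro x y
    rw [hF, matTrace_apply_fixedPoints hQ hX hm, hbe]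
    refine Finset.sum_congr rfl fun γ _ => ?_
    simp only [m, Subtype.coe_prop, and_self, dif_pos, Subtype.coe_eta]
    rw [← hc, mul_inv_cancel_left₀ hc0]
  have hFG : MatInvariant (⊤ : Subgroup G) F := matTrace_invariant hm
  let f : Module.End k k[Ω] := toMat.symm F
  have hfF : toMat f = F := AlgEquiv.apply_symm_apply _ _
  have hfG : ∀ g v, f (σ g v) = σ g (f v) := fun g =>
    (commutes_iff_toMat f g).2 (by rw [hfF]; exact hFG g trivial)
  -- An element of minimal rank among these idempotents has an indecomposable range: if the range
  -- split, both projections would have smaller rank, so they and hence their sum would vanish on `X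
  -- × X`.
  let S : Set (Module.End k k[Ω]) := {E | IsIdempotentElem E ∧ (∀ g v, E (σ g v) = σ g (E v)) ∧
    IsRelTrace σ Q E ∧ ∃ x ∈ X, ∃ y ∈ X, toMat E x y ≠ 0}
  have hSne : S.Nonempty := by
    obtain ⟨a, n, h1, h2⟩ := exists_fitting_idempotent (k := k) f
    have hcomm : ∀ g v, (Polynomial.aeval f a * f ^ n) (σ g v) =
        σ g ((Polynomial.aeval f a * f ^ n) v) := by
      intro g
      have h3 : Commute f (σ g) := LinearMap.ext (hfG g)
      have h4 : Commute (Polynomial.aeval f a) (σ g) := by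
        refine (Algebra.commute_of_mem_adjoin_of_forall_mem_commute
          (Polynomial.aeval_mem_adjoin_singleton k f) ?_).symm
        intro b hb
        rw [Set.mem_singleton_iff.1 hb]
        exact h3.symm
      exact LinearMap.congr_fun (h4.mul_left (h3.pow_left n))
    have htr : IsRelTrace σ Q (Polynomial.aeval f a * f ^ n * f) := by
      have h3 : IsRelTrace σ Q f := (isRelTrace_iff_toMat Q f).2 ⟨m, hm, hfF⟩
      exact h3.comp (σ := σ) (Polynomial.aeval f a * f ^ n) LinearMap.id hcomm fun _ _ => rfl
    refine ⟨_, h1, fun g v => ?_, htr, ?_⟩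
    · change (Polynomial.aeval f a * f ^ n) (f (σ g v)) =
        σ g ((Polynomial.aeval f a * f ^ n) (f v))
      rw [hfG, hcomm]
    -- The Fitting idempotent fixes `f ^ (n + 1)`, whose restriction to `X` is the nonzero `e`; so
    -- it cannot vanish on `X × X`.
    · by_contra! h0
      obtain ⟨m', hm', hE⟩ := (isRelTrace_iff_toMat Q _).1 htr
      have h3 := toMat_pow_apply hQ hX (hFG.mono le_top) (fun x y => by simp only [hFe, hee]) n
      apply he0
      rw [← hFe, ← h3.2, ← hfF, ← map_pow, ← h2, map_mul, mul_apply_fixedPoints hQ hX]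
      · exact Finset.sum_eq_zero fun z _ => by rw [h0 _ x₀.2 _ z.2, zero_mul]
      · rw [hE]
        exact (matTrace_invariant hm').mono le_top
      · rw [map_pow, hfF]
        exact h3.1
  obtain ⟨E, ⟨hEE, hEG, hEQ, hE0⟩, hmin⟩ :=
    WellFounded.has_min (measure fun E : Module.End k k[Ω] =>
      Module.finrank k (LinearMap.range E)).wf S hSne
  let W : Subrepresentation σ := ⟨LinearMap.range E, by
    rintro g _ ⟨v, rfl⟩
    exact ⟨σ g v, hEG g v⟩⟩
  set ρ := W.toRepresentation with hρ
  let i : W.toSubmodule →ₗ[k] k[Ω] := W.toSubmodule.subtype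
  let r : k[Ω] →ₗ[k] W.toSubmodule := E.rangeRestrict
  have hi : ∀ g v, i (ρ g v) = σ g (i v) := fun g v => rfl
  have hr : ∀ g v, r (σ g v) = ρ g (r v) := fun g v => Subtype.ext (hEG g v)
  have hri : ∀ v, r (i v) = v := by
    rintro ⟨_, v, rfl⟩
    exact Subtype.ext (LinearMap.congr_fun hEE v)
  have hir : i ∘ₗ r = E := rfl
  have hIQ : IsRelTrace ρ Q LinearMap.id := by
    have := hEQ.comp (σ := ρ) r i hr hi
    convert this
    refine LinearMap.ext fun v => ?_
    change v = r (i (r (i v)))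
    rw [hri, hri]
  have key : ∀ (A B : Subrepresentation ρ) (h : IsCompl A.toSubmodule B.toSubmodule),
      B.toSubmodule ≠ ⊥ → ∀ x ∈ X, ∀ y ∈ X, toMat (i ∘ₗ A.toSubmodule.subtype ∘ₗ
        A.toSubmodule.projectionOnto B.toSubmodule h ∘ₗ r) x y = 0 := by
    intro A B h hB
    set π : W.toSubmodule →ₗ[k] W.toSubmodule := A.toSubmodule.subtype ∘ₗ
        A.toSubmodule.projectionOnto B.toSubmodule h with hπ
    have hπG : ∀ g v, π (ρ g v) = ρ g (π v) := fun g v => projectionOnto_comm A B h g v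
    have hππ : ∀ v, π (π v) = π v := by
      intro v
      simp [hπ]
    change ∀ x ∈ X, ∀ y ∈ X, toMat (i ∘ₗ π ∘ₗ r) x y = 0
    by_contra! h0
    refine hmin (i ∘ₗ π ∘ₗ r) ⟨?_, ?_, ?_, h0⟩ ?_
    · refine LinearMap.ext fun v => ?_
      change i (π (r (i (π (r v))))) = i (π (r v))
      rw [hri, hππ]
    · intro g v
      change i (π (r (σ g v))) = σ g (i (π (r v)))
      rw [hr, hπG, hi]
    · have h1 := hEQ.comp (σ := σ) (i ∘ₗ π ∘ₗ r) LinearMap.id (fun g v => by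
        change i (π (r (σ g v))) = σ g (i (π (r v)))
        rw [hr, hπG, hi]) (fun _ _ => rfl)
      convert h1
      refine LinearMap.ext fun v => ?_
      change _ = i (π (r (i (r v))))
      rw [hri]
      rfl
    · change Module.finrank k (LinearMap.range (i ∘ₗ π ∘ₗ r)) < Module.finrank k W.toSubmodule
      have h1 : LinearMap.range (i ∘ₗ π ∘ₗ r) ≤ A.toSubmodule.map i := by
        rintro _ ⟨v, rfl⟩
        exact ⟨π (r v), Subtype.property _, rfl⟩
      have h2 := Submodule.finrank_mono h1
      have h3 := Submodule.finrank_map_le i A.toSubmodule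
      have h4 := Submodule.finrank_add_eq_of_isCompl h
      have h5 : 0 < Module.finrank k B.toSubmodule := by
        rw [Nat.pos_iff_ne_zero]
        intro h
        exact hB (Submodule.finrank_eq_zero.1 h)
      omega
  obtain ⟨x, hx, y, hy, hxy⟩ := hE0
  refine ⟨W.toSubmodule, _, _, ρ, ⟨?_, fun A B h => ?_⟩, ⟨⟨i, fun g => LinearMap.ext (hi g)⟩,
    ⟨r, fun g => LinearMap.ext (hr g)⟩, hri⟩, Q, ⟨?_, fun R hR hRQ => ?_⟩, hX⟩
  · by_contra hnt
    rw [not_nontrivial_iff_subsingleton] at hnt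
    apply hxy
    have : E = 0 := by
      rw [← hir]
      refine LinearMap.ext fun v => ?_
      change i (r v) = 0
      rw [Subsingleton.elim (r v) 0, map_zero]
    rw [this]
    simp
  · by_contra! hAB
    have h1 := key A B h hAB.2 x hx y hy
    have h2 := key B A h.symm hAB.1 x hx y hy
    apply hxy
    rw [← add_zero (0 : k)]
    nth_rw 1 [← h1]
    rw [← h2, ← Matrix.add_apply, ← map_add]
    refine congrFun (congrFun (congrArg toMat ?_) x) y
    refine LinearMap.ext fun v => ?_
    change i (r v) = i _ + i _
    rw [← map_add]
    exact congrArg i (Submodule.projection_add_projection_eq_self h (r v)).symm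
  · exact (isComponentOfInduced_iff ρ Q).2 hIQ
  -- No conjugate of `Q` fits in a proper subgroup `R` of it, so a trace from `R` would vanish on `X
  -- × X`, and `E` does not.
  · by_contra hQR
    have hlt : R < Q := lt_of_le_not_ge hRQ hQR
    have h1 := ((isComponentOfInduced_iff ρ R).1 hR).comp (σ := σ) i r hi hr
    obtain ⟨m', hm', h2⟩ := (isRelTrace_iff_toMat R _).1 h1
    apply hxy
    have h3 : i ∘ₗ LinearMap.id ∘ₗ r = E := rfl
    rw [← h3, h2]
    exact matTrace_apply_eq_zero hQ (not_conj_le_of_lt hlt) hm' (hX ▸ hx) (hX ▸ hy)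

end

end FixedPointSets

/-! ### Transfer of projective idempotents to other permutation groups. -/

namespace FixedPointSets

theorem bijective_out_mul {G : Type*} [Group G] (K : Subgroup G) :
    Function.Bijective fun a : (G ⧸ K) × K => a.1.out * (a.2 : G) := by
  constructor
  · rintro ⟨q, u⟩ ⟨q', u'⟩ h
    have h1 : ∀ (q : G ⧸ K) (u : K), ((q.out * (u : G) : G) : G ⧸ K) = q := fun q u => by
      rw [QuotientGroup.mk_mul_of_mem _ u.2]
      simp
    have h2 : q = q' := by rw [← h1 q u, ← h1 q' u', show q.out * (u : G) = q'.out * u' from h]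
    subst h2
    exact Prod.ext rfl (Subtype.ext (mul_left_cancel h))
  · intro g
    refine ⟨((g : G ⧸ K), ⟨(g : G ⧸ K).out⁻¹ * g, QuotientGroup.eq.1 (by simp)⟩), by simp⟩

section

variable {k : Type*} [Field k]

/-- Restriction to a subgroup preserves projectivity. The sum over `H` is a sum over `K`, the
preimage of `Γ`, and over coset representatives; the map from `K` onto `Γ` has fibres of constant
size `c`, which enters the new `b` as a factor. -/
theorem HasProjectiveIdempotent.of_hom {X H : Type*} [Fintype X] [Group H] [Fintype H]
    (φ : H →* Equiv.Perm X) {Γ : Subgroup (Equiv.Perm X)} (hΓ : Γ ≤ φ.range) {b e : X → X → k}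
    (he : ∀ x y, e x y = ∑ h : H, b (φ h x) (φ h y))
    (hee : ∀ x y, ∑ z, e x z * e z y = e x y) (he0 : ∃ x y, e x y ≠ 0) :
    HasProjectiveIdempotent k Γ := by
  classical
  let K := Γ.comap φ
  let ψ : K →* Γ := (φ.comp K.subtype).codRestrict Γ fun u => u.2
  have hψ : Function.Surjective ψ := by
    rintro ⟨γ, hγ⟩
    obtain ⟨h, rfl⟩ := hΓ hγ
    exact ⟨⟨h, hγ⟩, rfl⟩
  obtain ⟨c, hc⟩ : ∃ c : ℕ, ∀ γ : Γ, (Finset.univ.filter fun u => ψ u = γ).card = c :=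
    ⟨_, fun γ => MonoidHom.card_fiber_eq_of_mem_range ψ (hψ γ) (hψ 1)⟩
  rw [hasProjectiveIdempotent_iff]
  refine ⟨fun x y => ∑ q : H ⧸ K, (c : k) * b (φ q.out x) (φ q.out y), e, fun x y => ?_, hee, he0⟩
  rw [he, Finset.sum_comm]
  rw [← (bijective_out_mul K).sum_comp, Fintype.sum_prod_type]
  refine Finset.sum_congr rfl fun q _ => ?_
  have h2 : ∀ u : K, b (φ (q.out * (u : H)) x) (φ (q.out * (u : H)) y) =
      b (φ q.out ((ψ u).1 x)) (φ q.out ((ψ u).1 y)) := fun u => by rw [map_mul]; rfl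
  simp only [h2]
  rw [Finset.sum_comp (fun γ : Γ => b (φ q.out (γ.1 x)) (φ q.out (γ.1 y))) ψ,
    Finset.image_univ_of_surjective hψ]
  refine Finset.sum_congr rfl fun γ _ => ?_
  rw [hc, nsmul_eq_mul]

theorem HasProjectiveIdempotent.of_equiv {X X' : Type*} [Finite X] [Finite X'] (ε : X ≃ X')
    {Γ : Subgroup (Equiv.Perm X)} {Γ' : Subgroup (Equiv.Perm X')}
    (hΓ : ∀ γ' ∈ Γ', ∃ γ ∈ Γ, ∀ x, ε (γ x) = γ' (ε x)) (h : HasProjectiveIdempotent k Γ) :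
    HasProjectiveIdempotent k Γ' := by
  classical
  have := Fintype.ofFinite X
  have := Fintype.ofFinite X'
  obtain ⟨b, e, he, hee, x₀, y₀, h0⟩ := hasProjectiveIdempotent_iff.1 h
  refine HasProjectiveIdempotent.of_hom (H := Γ) ((ε.permCongrHom).toMonoidHom.comp Γ.subtype)
    (b := fun x y => b (ε.symm x) (ε.symm y)) (e := fun x y => e (ε.symm x) (ε.symm y)) ?_ ?_ ?_
    ⟨ε x₀, ε y₀, by simpa using h0⟩
  · intro γ' hγ'
    obtain ⟨γ, hγ, h⟩ := hΓ γ' hγ'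
    refine ⟨⟨γ, hγ⟩, ?_⟩
    ext x
    have := h (ε.symm x)
    rw [ε.apply_symm_apply] at this
    rw [← this]
    rfl
  · intro x y
    rw [he]
    simp [Equiv.permCongrHom]
  · intro x y
    rw [← hee, ← ε.symm.sum_comp]

/-- The action of the wreath product of `Γ` with `Sym(s)` on `X^s`. -/
def wreathHom {X : Type*} (Γ : Subgroup (Equiv.Perm X)) (s : ℕ) :
    (Fin s → Γ) ⋊[mulAutArrow] Equiv.Perm (Fin s) →* Equiv.Perm (Fin s → X) where
  toFun w :=
    { toFun := fun x i => (w.left i).1 (x (w.right⁻¹ i))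
      invFun := fun x i => (w.left (w.right i)).1⁻¹ (x (w.right i))
      left_inv := fun x => by ext; simp
      right_inv := fun x => by ext; simp }
  map_one' := by ext; simp
  map_mul' v w := by ext; simp [mulAutArrow]; rfl

/-- The tensor power of `e` is the sum of the tensor power of `b` over the base group. Summing over
`Sym(s)` as well only multiplies by `s!`, which is invertible because `s < p`. -/
theorem HasProjectiveIdempotent.of_wreath {p : ℕ} [Fact p.Prime] [CharP k p] {X X' : Type*}
    [Finite X] [Finite X'] {s : ℕ} (hs : s < p) (ε : (Fin s → X) ≃ X')
    {Γ : Subgroup (Equiv.Perm X)} {Γ' : Subgroup (Equiv.Perm X')}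
    (hΓ : ∀ γ' ∈ Γ', ∃ (g : Fin s → Equiv.Perm X) (π : Equiv.Perm (Fin s)), (∀ i, g i ∈ Γ) ∧
      ∀ x, γ' (ε x) = ε fun i => g i (x (π i))) (h : HasProjectiveIdempotent k Γ) :
    HasProjectiveIdempotent k Γ' := by
  classical
  have := Fintype.ofFinite X
  have := Fintype.ofFinite X'
  obtain ⟨b, e, he, hee, x₀, y₀, h0⟩ := hasProjectiveIdempotent_iff.1 h
  have hfact : (s.factorial : k) ≠ 0 := by
    rw [Ne, CharP.cast_eq_zero_iff k p, Nat.Prime.dvd_factorial Fact.out]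
    omega
  have : Fintype ((Fin s → Γ) ⋊[mulAutArrow] Equiv.Perm (Fin s)) :=
    Fintype.ofEquiv _ SemidirectProduct.equivProd.symm
  suffices h : HasProjectiveIdempotent k (wreathHom Γ s).range by
    refine h.of_equiv ε fun γ' hγ' => ?_
    obtain ⟨g, π, hg, h⟩ := hΓ γ' hγ'
    exact ⟨_, ⟨⟨fun i => ⟨g i, hg i⟩, π⁻¹⟩, rfl⟩, fun x => by rw [h]; simp [wreathHom]; rfl⟩
  refine HasProjectiveIdempotent.of_hom (wreathHom Γ s) le_rfl
    (b := fun x y => (s.factorial : k)⁻¹ * ∏ i, b (x i) (y i)) (e := fun x y => ∏ i, e (x i) (y i))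
    ?_ ?_ ⟨fun _ => x₀, fun _ => y₀, Finset.prod_ne_zero_iff.2 fun _ _ => h0⟩
  · intro x y
    rw [← SemidirectProduct.equivProd.symm.sum_comp, Fintype.sum_prod_type, Finset.sum_comm]
    have h1 : ∀ π : Equiv.Perm (Fin s), ∑ g : Fin s → Γ, (s.factorial : k)⁻¹ *
        ∏ i, b ((g i).1 (x (π⁻¹ i))) ((g i).1 (y (π⁻¹ i))) =
        (s.factorial : k)⁻¹ * ∏ i, e (x i) (y i) := by
      intro π
      rw [← Finset.mul_sum]
      congr 1
      rw [← Equiv.prod_comp π⁻¹]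
      simp only [he]
      rw [Finset.prod_univ_sum, Fintype.piFinset_univ]
    refine Eq.trans ?_ (Finset.sum_congr rfl fun π _ => (h1 π).symm)
    rw [Finset.sum_const, Finset.card_univ, Fintype.card_perm, Fintype.card_fin, nsmul_eq_mul,
      mul_inv_cancel_left₀ hfact]
  · intro x y
    simp only [← Finset.prod_mul_distrib]
    rw [Finset.prod_congr rfl fun i _ => (hee (x i) (y i)).symm, Finset.prod_univ_sum, Fintype.piFinset_univ]

end

end FixedPointSets

/-! ### Cycles through minimal periods, and the family `𝒮^q`. -/

namespace FixedPointSets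

open Equiv Function

section Periods

variable {α β : Type*}

theorem minimalPeriod_eq_of_semiconj_on {f : α → α} {f' : β → β} {ι : β → α} {T : Set β}
    (hι : Set.InjOn ι T) (hT : ∀ m ∈ T, f' m ∈ T) (h : ∀ m ∈ T, f (ι m) = ι (f' m)) {m : β}
    (hm : m ∈ T) : minimalPeriod f (ι m) = minimalPeriod f' m := by
  have key : ∀ n : ℕ, f'^[n] m ∈ T ∧ f^[n] (ι m) = ι (f'^[n] m) := by
    intro n
    induction n with
    | zero => exact ⟨hm, rfl⟩
    | succ n ih =>
      rw [iterate_succ_apply', iterate_succ_apply', ih.2]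
      exact ⟨hT _ ih.1, h _ ih.1⟩
  rw [minimalPeriod_eq_minimalPeriod_iff]
  intro n
  unfold IsPeriodicPt IsFixedPt
  rw [(key n).2]
  exact ⟨fun h => hι (key n).1 hm h, fun h => by rw [h]⟩

theorem _root_.Equiv.Perm.IsCycle.minimalPeriod_eq {c : Perm α} (hc : c.IsCycle)
    (hfin : {y | c y ≠ y}.Finite) {x : α} (hx : c x ≠ x) :
    minimalPeriod c x = {y | c y ≠ y}.ncard := by
  have h1 : MulAction.orbit (Subgroup.zpowers c) x = {y | c y ≠ y} := by
    ext y
    constructor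
    · rintro ⟨⟨_, n, rfl⟩, rfl⟩
      have h2 : c.SameCycle x ((c ^ n) x) := ⟨n, rfl⟩
      exact fun h => hx (h2.apply_eq_self_iff.2 h)
    · intro hy
      obtain ⟨n, hn⟩ := hc.sameCycle hx hy
      exact ⟨⟨c ^ n, n, rfl⟩, hn⟩
  have := hfin.fintype
  have := Fintype.ofEquiv _ (Equiv.setCongr h1.symm)
  have h2 := MulAction.minimalPeriod_eq_card c x
  rw [← Nat.card_eq_fintype_card, h1] at h2
  exact h2

theorem list_prod_apply_of_pairwise_disjoint {l : List (Perm α)} (hl : l.Pairwise Perm.Disjoint)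
    {c : Perm α} (hc : c ∈ l) {x : α} (hx : c x ≠ x) : l.prod x = c x := by
  induction l with
  | nil => simp at hc
  | cons a l ih =>
    rw [List.pairwise_cons] at hl
    rw [List.prod_cons, Perm.mul_apply]
    rcases List.mem_cons.1 hc with rfl | hc
    · rw [((Perm.disjoint_prod_right l hl.1) x).resolve_left hx]
    · rw [ih hl.2 hc]
      refine ((hl.1 c hc) (c x)).resolve_right fun h => hx ?_
      exact c.injective h

theorem exists_mem_of_list_prod_apply_ne {l : List (Perm α)} {x : α} (h : l.prod x ≠ x) :
    ∃ c ∈ l, c x ≠ x := by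
  induction l with
  | nil => simp at h
  | cons a l ih =>
    by_cases h1 : l.prod x = x
    · rw [List.prod_cons, Perm.mul_apply, h1] at h
      exact ⟨a, List.mem_cons_self, h⟩
    · obtain ⟨c, hc, hcx⟩ := ih h1
      exact ⟨c, List.mem_cons_of_mem _ hc, hcx⟩

theorem minimalPeriod_list_prod {l : List (Perm α)} (hl : l.Pairwise Perm.Disjoint)
    {c : Perm α} (hc : c ∈ l) {x : α} (hx : c x ≠ x) :
    minimalPeriod l.prod x = minimalPeriod c x :=
  minimalPeriod_eq_of_semiconj_on (ι := id) (T := {y | c y ≠ y}) (injective_id.injOn)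
    (fun _ hm h => hm (c.injective h))
    (fun _ hm => list_prod_apply_of_pairwise_disjoint hl hc hm) hx

theorem cycleType_eq_replicate [Fintype α] [DecidableEq α] {q : ℕ} (hq : 0 < q) {ρ : Perm α}
    (h : ∀ x, ρ x ≠ x) (hρ : ∀ x, minimalPeriod ρ x = q) :
    ρ.cycleType = Multiset.replicate (Fintype.card α / q) q := by
  have h1 : ρ.cycleType = Multiset.replicate ρ.cycleType.card q := by
    refine Multiset.eq_replicate_of_mem fun n hn => ?_
    obtain ⟨c, τ, hρc, hd, hc, rfl⟩ := Perm.mem_cycleType_iff.1 hn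
    obtain ⟨x, hx⟩ := hc.nonempty_support
    rw [Perm.mem_support] at hx
    have h2 := minimalPeriod_list_prod (l := [c, τ]) (by simpa using hd) (c := c) (by simp) hx
    rw [List.prod_cons, List.prod_singleton, ← hρc, hρ, hc.minimalPeriod_eq (Set.toFinite _) hx]
      at h2
    rw [h2, Set.ncard_eq_toFinset_card']
    congr 1
    ext y
    simp
  have h2 := ρ.sum_cycleType
  have h3 : ρ.support = Finset.univ := by
    ext x
    simp [h x]
  rw [h1, Multiset.sum_replicate, h3, Finset.card_univ, smul_eq_mul] at h2
  rw [← h2, Nat.mul_div_cancel _ hq]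
  exact h1

end Periods

theorem mem_supp {ρ : Perm ℕ} {n : ℕ} : n ∈ supp ρ ↔ ρ n ≠ n := Iff.rfl

theorem apply_mem_supp (ρ : Perm ℕ) (x : ℕ) : ρ x ∈ supp ρ ↔ x ∈ supp ρ :=
  not_congr ρ.injective.eq_iff

/-- Periods make the cycle condition pointwise, so that it can be checked on one block at a time. -/
theorem isProductOfCycles_iff {q : ℕ} {ρ : Perm ℕ} (hρ : (supp ρ).Finite) :
    IsProductOfCycles q ρ ↔ ∀ n ∈ supp ρ, minimalPeriod ρ n = q := by
  classical
  constructor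
  · rintro ⟨l, hl, hd, rfl⟩ n hn
    obtain ⟨c, hc, hcn⟩ := exists_mem_of_list_prod_apply_ne hn
    rw [minimalPeriod_list_prod hd hc hcn, ← (hl c hc).2]
    refine (hl c hc).1.minimalPeriod_eq (hρ.subset fun y hy => ?_) hcn
    rw [mem_supp, list_prod_apply_of_pairwise_disjoint hd hc hy]
    exact hy
  · intro h
    have := hρ.fintype
    let ρ' : Perm {x // x ∈ supp ρ} := ρ.subtypePerm (apply_mem_supp ρ)
    have hρ' : Perm.ofSubtype ρ' = ρ := Perm.ofSubtype_subtypePerm _ fun x hx => hx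
    obtain ⟨l, hl, hlc, hld⟩ := (Perm.truncCycleFactors ρ').out
    have hprod : (l.map Perm.ofSubtype).prod = ρ := by
      rw [← map_list_prod, hl, hρ']
    have hd : (l.map (Perm.ofSubtype (p := (· ∈ supp ρ)))).Pairwise Perm.Disjoint := by
      rw [List.pairwise_map]
      refine hld.imp fun {a b} hab x => ?_
      by_cases hx : x ∈ supp ρ
      · rw [Perm.ofSubtype_apply_of_mem a hx, Perm.ofSubtype_apply_of_mem b hx]
        exact (hab ⟨x, hx⟩).imp (congrArg Subtype.val) (congrArg Subtype.val)
      · exact Or.inl (Perm.ofSubtype_apply_of_not_mem _ hx)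
    refine ⟨_, fun c hc => ?_, hd, hprod⟩
    obtain ⟨c', hc', rfl⟩ := List.mem_map.1 hc
    have hcyc : (Perm.ofSubtype c').IsCycle := (hlc c' hc').extendDomain _
    refine ⟨hcyc, ?_⟩
    obtain ⟨x, hx, -⟩ := id hcyc
    have hsub : supp (Perm.ofSubtype c') ⊆ supp ρ := by
      intro y hy
      by_contra hy'
      exact hy (Perm.ofSubtype_apply_of_not_mem _ hy')
    have h1 := minimalPeriod_list_prod hd hc hx
    rw [hprod, h x (hsub hx), hcyc.minimalPeriod_eq (hρ.subset hsub) hx] at h1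
    exact h1.symm

theorem mem_symOn {T : Set ℕ} {g : Perm ℕ} : g ∈ symOn T ↔ ∀ n ∉ T, g n = n := by
  unfold symOn
  rw [mem_fixingSubgroup_iff]
  rfl

theorem apply_mem_of_mem_symOn {T : Set ℕ} {g : Perm ℕ} (hg : g ∈ symOn T) (n : ℕ) :
    g n ∈ T ↔ n ∈ T := by
  rw [mem_symOn] at hg
  by_cases h : n ∈ T
  · simp only [h, iff_true]
    by_contra h1
    exact h1 (by rwa [g.injective (hg _ h1)])
  · rw [hg n h]

theorem finite_symOn {T : Set ℕ} (hT : T.Finite) : Finite (symOn T) := by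
  have := hT.to_subtype
  refine Finite.of_injective
    (fun (g : symOn T) (t : T) => (⟨g.1 t, (apply_mem_of_mem_symOn g.2 _).2 t.2⟩ : T)) ?_
  intro g h hgh
  ext n
  by_cases hn : n ∈ T
  · exact congrArg Subtype.val (congrFun hgh ⟨n, hn⟩)
  · rw [mem_symOn.1 g.2 n hn, mem_symOn.1 h.2 n hn]

/-- A permutation that preserves `T` agrees on `T` with an element of `Sym(T)`. -/
theorem exists_mem_symOn_eqOn {T : Set ℕ} {g : Perm ℕ} (hg : ∀ n, g n ∈ T ↔ n ∈ T) :
    ∃ h ∈ symOn T, ∀ n ∈ T, h n = g n := by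
  classical
  refine ⟨Perm.ofSubtype (g.subtypePerm hg), mem_symOn.2 fun n hn =>
    Perm.ofSubtype_apply_of_not_mem _ hn, fun n hn => ?_⟩
  rw [Perm.ofSubtype_apply_of_mem _ hn]
  rfl

/-- Products of disjoint `q`-cycles with the same finite support are conjugate. -/
theorem exists_conj_of_minimalPeriod_eq {q : ℕ} (hq : 0 < q) {T : Set ℕ} (hT : T.Finite)
    {ρ ξ : Perm ℕ} (hρ : supp ρ = T) (hξ : supp ξ = T) (hρq : ∀ n ∈ T, minimalPeriod ρ n = q)
    (hξq : ∀ n ∈ T, minimalPeriod ξ n = q) : ∃ g ∈ symOn T, ξ = g * ρ * g⁻¹ := by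
  classical
  have := hT.fintype
  have key : ∀ ρ : Perm ℕ, supp ρ = T → (∀ n ∈ T, minimalPeriod ρ n = q) →
      ∃ ρ' : Perm {x // x ∈ T}, Perm.ofSubtype ρ' = ρ ∧
        ρ'.cycleType = Multiset.replicate (Fintype.card {x // x ∈ T} / q) q := by
    rintro ρ rfl hρ
    refine ⟨ρ.subtypePerm (apply_mem_supp ρ), Perm.ofSubtype_subtypePerm _ fun x hx => hx,
      cycleType_eq_replicate hq (fun x hx => x.2 (congrArg Subtype.val hx)) fun x => ?_⟩
    rw [← hρ x x.2]
    exact (minimalPeriod_eq_of_semiconj_on (ι := Subtype.val) (T := Set.univ)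
      Subtype.val_injective.injOn (fun _ _ => trivial) (fun _ _ => rfl) trivial).symm
  obtain ⟨ρ', rfl, h1⟩ := key ρ hρ hρq
  obtain ⟨ξ', rfl, h2⟩ := key ξ hξ hξq
  obtain ⟨g, hg⟩ := isConj_iff.1 (Perm.isConj_iff_cycleType_eq.2 (h1.trans h2.symm))
  refine ⟨Perm.ofSubtype g, mem_symOn.2 fun n hn => Perm.ofSubtype_apply_of_not_mem _ hn, ?_⟩
  rw [← hg]
  simp

section FamilyS

variable {q : ℕ} {X : Set (Perm ℕ)}

theorem supp_subset_setSupp {ρ : Perm ℕ} (hρ : ρ ∈ X) : supp ρ ⊆ setSupp X :=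
  Set.subset_biUnion_of_mem (u := supp) hρ

theorem finite_setSupp (hX : X ∈ familyF) : (setSupp X).Finite :=
  hX.1.biUnion hX.2.2.2

theorem setSupp_nonempty (hX : X ∈ familyF) : (setSupp X).Nonempty := by
  by_contra h
  rw [Set.not_nonempty_iff_eq_empty] at h
  refine hX.2.2.1 (Set.Nonempty.subset_singleton_iff hX.2.1 |>.1 fun ρ hρ => ?_)
  rw [Set.mem_singleton_iff]
  ext n
  by_contra hn
  exact Set.notMem_empty n (h ▸ supp_subset_setSupp hρ hn)

theorem mem_symOn_of_mem {ρ : Perm ℕ} (hρ : ρ ∈ X) : ρ ∈ groupG X := by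
  refine mem_symOn.2 fun n hn => ?_
  by_contra h
  exact hn (supp_subset_setSupp hρ h)

theorem minimalPeriod_of_mem_familyS (hX : X ∈ familyS q) {ρ : Perm ℕ} (hρ : ρ ∈ X) {n : ℕ}
    (hn : n ∈ setSupp X) : minimalPeriod ρ n = q :=
  (isProductOfCycles_iff (hX.1.2.2.2 ρ hρ)).1 (hX.2 ρ hρ).1 n ((hX.2 ρ hρ).2 ▸ hn)

theorem mem_familyS_of {T : Set ℕ} (hT : T.Finite) (hT' : T.Nonempty) (hne : X.Nonempty)
    (hX : ∀ ρ ∈ X, supp ρ = T ∧ ∀ n ∈ T, minimalPeriod ρ n = q) :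
    X ∈ familyS q ∧ setSupp X = T := by
  have h1 : setSupp X = T := by
    refine Set.Subset.antisymm (Set.iUnion₂_subset fun ρ hρ => (hX ρ hρ).1.le) ?_
    obtain ⟨ρ, hρ⟩ := hne
    rw [← (hX ρ hρ).1]
    exact supp_subset_setSupp hρ
  have hfin : ∀ ρ ∈ X, (supp ρ).Finite := fun ρ hρ => by rwa [(hX ρ hρ).1]
  refine ⟨⟨⟨?_, hne, ?_, hfin⟩, fun ρ hρ => ⟨?_, ?_⟩⟩, h1⟩
  · have := finite_symOn hT
    refine (Set.toFinite (symOn T : Set (Perm ℕ))).subset fun ρ hρ => mem_symOn.2 fun n hn => ?_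
    by_contra h
    exact hn ((hX ρ hρ).1 ▸ h)
  · rintro rfl
    have := (hX 1 rfl).1
    obtain ⟨n, hn⟩ := hT'
    rw [← this] at hn
    exact hn rfl
  · rw [isProductOfCycles_iff (hfin ρ hρ), (hX ρ hρ).1]
    exact (hX ρ hρ).2
  · rw [h1, (hX ρ hρ).1]

/-- Permutations of the same cycle type are conjugate. Thus `Ξ_X` depends only on `q` and the
support, and consists of all products of `q`-cycles with that support. -/
theorem mem_Xi_iff (hq : 2 ≤ q) (hX : X ∈ familyS q) {ξ : Perm ℕ} : ξ ∈ Xi X ↔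
    supp ξ = setSupp X ∧ ∀ n ∈ setSupp X, minimalPeriod ξ n = q := by
  constructor
  · rintro ⟨g, hg, y, hy, rfl⟩
    have hsupp : supp (g * y * g⁻¹) = setSupp X := by
      ext n
      rw [← (hX.2 y hy).2, mem_supp]
      have h1 : (g * y * g⁻¹) n ≠ n ↔ g⁻¹ n ∈ supp y := by
        rw [mem_supp, not_iff_not, Perm.mul_apply, Perm.mul_apply]
        exact ⟨fun h => by rw [Perm.eq_inv_iff_eq]; exact h, fun h => by rw [h]; simp⟩
      rw [h1, (hX.2 y hy).2, apply_mem_of_mem_symOn (inv_mem hg)]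
    refine ⟨hsupp, fun n hn => ?_⟩
    have hn' : g⁻¹ n ∈ setSupp X := (apply_mem_of_mem_symOn (inv_mem hg) n).2 hn
    rw [← minimalPeriod_of_mem_familyS hX hy hn']
    have := minimalPeriod_eq_of_semiconj_on (f := g * y * g⁻¹) (f' := y) (ι := g) (T := Set.univ)
      g.injective.injOn (fun _ _ => trivial) (fun _ _ => by simp) (m := g⁻¹ n) trivial
    simpa using this
  · rintro ⟨h1, h2⟩
    obtain ⟨y, hy⟩ := hX.1.2.1
    obtain ⟨g, hg, h⟩ := exists_conj_of_minimalPeriod_eq (by omega) (finite_setSupp hX.1)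
      (hX.2 y hy).2 h1 (fun n hn => minimalPeriod_of_mem_familyS hX hy hn) h2
    exact ⟨g, hg, y, hy, h⟩

end FamilyS

end FixedPointSets

/-! ### The criterion for fixed point sets, stated inside `Sym(ℕ)`. -/

namespace FixedPointSets

open Equiv Function

/-- The permutations of `X` that are induced by conjugation with elements of `Sym(supp X)`. -/
def conjPerms (X : Set (Perm ℕ)) : Subgroup (Perm X) where
  carrier := {γ | ∃ g ∈ groupG X, ∀ x : X, g * x * g⁻¹ = γ x}
  one_mem' := ⟨1, one_mem _, fun x => by simp⟩
  mul_mem' := by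
    rintro γ δ ⟨g, hg, hgγ⟩ ⟨h, hh, hhδ⟩
    refine ⟨g * h, mul_mem hg hh, fun x => ?_⟩
    rw [Perm.mul_apply, ← hgγ, ← hhδ]
    group
  inv_mem' := by
    rintro γ ⟨g, hg, hgγ⟩
    refine ⟨g⁻¹, inv_mem hg, fun x => ?_⟩
    have := hgγ (γ⁻¹ x)
    rw [show γ (γ⁻¹ x) = x from γ.apply_symm_apply x] at this
    rw [← this]
    group

section

variable {q : ℕ} {X : Set (Perm ℕ)}

theorem subset_Xi : X ⊆ Xi X := fun x hx => ⟨1, one_mem _, x, hx, by simp⟩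

theorem finite_Xi (hX : X ∈ familyF) : Finite (Xi X) := by
  have := finite_symOn (finite_setSupp hX)
  refine ((Set.toFinite (groupG X : Set (Perm ℕ))).subset ?_).to_subtype
  rintro _ ⟨g, hg, y, hy, rfl⟩
  exact mul_mem (mul_mem hg (mem_symOn_of_mem hy)) (inv_mem hg)

/-- `X` as a subset of `Ξ_X`. -/
abbrev inXi (X : Set (Perm ℕ)) : Set (Xi X) := {x : Xi X | (x : Perm ℕ) ∈ X}

theorem coe_smul_Xi (g : groupG X) (x : Xi X) : ((g • x : Xi X) : Perm ℕ) = g * x * (g : Perm ℕ)⁻¹ :=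
  rfl

theorem map_fixingSubgroup_inXi :
    (fixingSubgroup (groupG X) (inXi X)).map (groupG X).subtype = groupS X := by
  ext g
  constructor
  · rintro ⟨g, hg, rfl⟩
    refine ⟨g.2, Subgroup.mem_centralizer_iff.2 fun x hx => ?_⟩
    have := congrArg Subtype.val ((mem_fixingSubgroup_iff _).1 hg ⟨x, subset_Xi hx⟩ hx)
    rw [coe_smul_Xi, mul_inv_eq_iff_eq_mul] at this
    exact this.symm
  · rintro ⟨hg, hgX⟩
    refine ⟨⟨g, hg⟩, (mem_fixingSubgroup_iff _).2 fun x hx => Subtype.ext ?_, rfl⟩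
    rw [coe_smul_Xi, mul_inv_eq_iff_eq_mul]
    exact (Subgroup.mem_centralizer_iff.1 hgX x hx).symm

/-- The elements of `X`, as elements of `Ξ_X`. -/
def inXiEquiv (X : Set (Perm ℕ)) : inXi X ≃ X where
  toFun x := ⟨x.1.1, x.2⟩
  invFun x := ⟨⟨x.1, subset_Xi x.2⟩, x.2⟩
  left_inv _ := rfl
  right_inv _ := rfl

theorem relIndex_map_subtype {G : Type*} [Group G] {S : Subgroup G} (P : Subgroup S) :
    (P.map S.subtype).relIndex S = P.index := by
  rw [Subgroup.relIndex, ← Subgroup.comap_subtype,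
    Subgroup.comap_map_eq_self_of_injective S.subtype_injective]

variable {k : Type*} [Field k] {p : ℕ} [Fact p.Prime] [CharP k p]

theorem IsFixedPointSet.exists_subgroup (hX : X ∈ familyF) (h : IsFixedPointSet k X) :
    ∃ Q ≤ groupS X, IsPGroup p Q ∧ ¬ p ∣ Q.relIndex (groupS X) ∧
      (∀ ξ ∈ Xi X, (∀ u ∈ Q, u * ξ * u⁻¹ = ξ) → ξ ∈ X) ∧
      ∃ _ : Finite X, HasProjectiveIdempotent k (conjPerms X) := by
  have := finite_symOn (finite_setSupp hX)
  have := finite_Xi hX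
  have hfin : Finite X := hX.1.to_subtype
  obtain ⟨Q, hQ, hQX, hindex, hP⟩ := IsFixedPointSubset.exists_vertex (p := p) h
  refine ⟨Q.map (groupG X).subtype, ?_, hQ.map _, ?_, fun ξ hξ hξQ => ?_, hfin, ?_⟩
  · rw [← map_fixingSubgroup_inXi]
    refine Subgroup.map_mono fun u hu => (mem_fixingSubgroup_iff _).2 fun x hx => ?_
    have hx' : x ∈ MulAction.fixedPoints Q (Xi X) := hQX ▸ hx
    exact hx' ⟨u, hu⟩
  · rw [← map_fixingSubgroup_inXi, Subgroup.relIndex_map_map_of_injective _ _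
      (groupG X).subtype_injective]
    exact hindex
  · have : (⟨ξ, hξ⟩ : Xi X) ∈ MulAction.fixedPoints Q (Xi X) := fun u =>
      Subtype.ext (hξQ _ ⟨u, u.2, rfl⟩)
    rw [← hQX] at this
    exact this
  · refine hP.of_equiv (inXiEquiv X) ?_
    rintro γ' ⟨g, hg, hgγ⟩
    refine ⟨(inXiEquiv X).symm.permCongr γ', ⟨⟨g, hg⟩, fun x => Subtype.ext ?_⟩, fun x => ?_⟩
    · exact hgγ (inXiEquiv X x)
    · simp

/-- The group `Q` need not be Sylow in `S_X`. A Sylow subgroup containing it still fixes `X`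
pointwise and has no more fixed points than `Q`, so its fixed point set is also `X`. -/
theorem isFixedPointSet_of_subgroup (hX : X ∈ familyF) {Q : Subgroup (Perm ℕ)}
    (hQS : Q ≤ groupS X) (hQ : IsPGroup p Q) (hfix : ∀ ξ ∈ Xi X, (∀ u ∈ Q, u * ξ * u⁻¹ = ξ) → ξ ∈ X)
    [Finite X] (hP : HasProjectiveIdempotent k (conjPerms X)) : IsFixedPointSet k X := by
  have := finite_symOn (finite_setSupp hX)
  have := finite_Xi hX
  have : Finite (groupS X) := Finite.of_injective (Subgroup.inclusion
    (inf_le_left : groupS X ≤ groupG X)) (Subgroup.inclusion_injective _)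
  obtain ⟨P, hP'⟩ := (IsPGroup.comap_subtype hQ (K := groupS X)).exists_le_sylow
  have hQP : Q ≤ P.map (groupS X).subtype := by
    intro u hu
    exact ⟨⟨u, hQS hu⟩, hP' (Subgroup.mem_subgroupOf.2 hu), rfl⟩
  have hPS : P.map (groupS X).subtype ≤ groupS X := Subgroup.map_subtype_le _
  refine isFixedPointSubset_of_hasProjectiveIdempotent (p := p)
    (Q := (P.map (groupS X).subtype).subgroupOf (groupG X))
    (IsPGroup.comap_subtype (P.2.map _)) ?_ ?_ ?_
  · ext x
    constructor
    · rintro hx ⟨u, hu⟩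
      refine Subtype.ext ?_
      change (u : Perm ℕ) * x * (u : Perm ℕ)⁻¹ = x
      have := Subgroup.mem_centralizer_iff.1 (hPS (Subgroup.mem_subgroupOf.1 hu)).2 x hx
      rw [← this, mul_inv_cancel_right]
    · intro hx
      refine hfix x x.2 fun u hu => ?_
      exact congrArg Subtype.val (hx ⟨⟨u, (hQS hu).1⟩, Subgroup.mem_subgroupOf.2 (hQP hu)⟩)
  · rw [← Subgroup.comap_subtype, Subgroup.relIndex_comap, map_fixingSubgroup_inXi,
      relIndex_map_subtype]
    exact P.not_dvd_index
  · refine hP.of_equiv (inXiEquiv X).symm ?_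
    rintro γ' ⟨⟨g, hg⟩, hgγ⟩
    refine ⟨(inXiEquiv X).permCongr γ', ⟨g, hg, fun x => ?_⟩, fun x => ?_⟩
    · exact congrArg Subtype.val (hgγ ((inXiEquiv X).symm x))
    · simp

/-- A `p`-subgroup of index prime to `p` yields a Sylow subgroup of `S_X`, to which exactness
applies. -/
theorem IsExact.exists_apply_ne (hX : IsExact p X) {Q : Subgroup (Perm ℕ)}
    (hQ : IsPGroup p Q) (hindex : ¬ p ∣ Q.relIndex (groupS X)) {n : ℕ}
    (hn : n ∈ setSupp X) : ∃ u ∈ Q, u n ≠ n := by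
  have h := hX ((IsPGroup.comap_subtype hQ (K := groupS X)).toSylow hindex)
  rw [← h] at hn
  simp only [setSupp, Set.mem_iUnion] at hn
  obtain ⟨_, ⟨x, hx, rfl⟩, hn⟩ := hn
  exact ⟨x, Subgroup.mem_subgroupOf.1 hx, hn⟩

end

end FixedPointSets

/-! ### Wreath products on disjoint blocks, and their fixed points. -/

namespace FixedPointSets

open Equiv Function

section Blocks

variable {T : Set ℕ} {s : ℕ} {σ : Fin s → Perm ℕ}

/-- The union of the translates `σ i '' T`. -/
def blockUnion (T : Set ℕ) {s : ℕ} (σ : Fin s → Perm ℕ) : Set ℕ := ⋃ i, σ i '' T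

theorem mem_blockUnion {n : ℕ} : n ∈ blockUnion T σ ↔ ∃ i, ∃ m ∈ T, σ i m = n := by
  simp only [blockUnion, Set.mem_iUnion, Set.mem_image]

theorem apply_mem_blockUnion (i : Fin s) {m : ℕ} (hm : m ∈ T) : σ i m ∈ blockUnion T σ :=
  mem_blockUnion.2 ⟨i, m, hm, rfl⟩

theorem finite_blockUnion (hT : T.Finite) (σ : Fin s → Perm ℕ) : (blockUnion T σ).Finite :=
  Set.finite_iUnion fun _ => hT.image _

/-- The translates `σ i '' T` are pairwise disjoint. -/
def DisjointBlocks (T : Set ℕ) {s : ℕ} (σ : Fin s → Perm ℕ) : Prop :=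
  ∀ i j, i ≠ j → Disjoint (σ i '' T) (σ j '' T)

theorem DisjointBlocks.eq (hσ : DisjointBlocks T σ) {i j : Fin s} {m m' : ℕ} (hm : m ∈ T)
    (hm' : m' ∈ T) (h : σ i m = σ j m') : i = j ∧ m = m' := by
  by_cases hij : i = j
  · subst hij
    exact ⟨rfl, (σ i).injective h⟩
  · exact (Set.disjoint_left.1 (hσ i j hij) ⟨m, hm, rfl⟩ ⟨m', hm', h.symm⟩).elim

theorem ext_blocks {g h : Perm ℕ} (hg : g ∈ symOn (blockUnion T σ))
    (hh : h ∈ symOn (blockUnion T σ)) (hgh : ∀ i, ∀ m ∈ T, g (σ i m) = h (σ i m)) : g = h := by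
  ext n
  by_cases hn : n ∈ blockUnion T σ
  · obtain ⟨i, m, hm, rfl⟩ := mem_blockUnion.1 hn
    exact hgh i m hm
  · rw [mem_symOn.1 hg n hn, mem_symOn.1 hh n hn]

/-- Permutations of the blocks, followed by permutations within the blocks. -/
theorem DisjointBlocks.exists_glue (hσ : DisjointBlocks T σ) (π : Perm (Fin s))
    (u : Fin s → Perm ℕ) (hu : ∀ i, u i ∈ symOn T) :
    ∃ g ∈ symOn (blockUnion T σ), ∀ i, ∀ m ∈ T, g (σ i m) = σ (π i) (u i m) := by
  let ι : Fin s × T ↪ ℕ := ⟨fun x => σ x.1 x.2, fun x y h => by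
    have := hσ.eq x.2.2 y.2.2 h
    exact Prod.ext this.1 (Subtype.ext this.2)⟩
  let e : Perm (Fin s × T) :=
    Equiv.prodShear π fun i => (u i).subtypePerm (apply_mem_of_mem_symOn (hu i))
  refine ⟨e.viaEmbedding ι, mem_symOn.2 fun n hn => ?_, fun i m hm => ?_⟩
  · refine Perm.viaEmbedding_apply_of_notMem e ι n fun ⟨x, hx⟩ => hn ?_
    rw [← hx]
    exact apply_mem_blockUnion _ x.2.2
  · exact Perm.viaEmbedding_apply e ι (i, ⟨m, hm⟩)

theorem DisjointBlocks.embed_spec (hσ : DisjointBlocks T σ) {y : Fin s → Perm ℕ}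
    (hy : ∀ i, y i ∈ symOn T) : embed σ y ∈ symOn (blockUnion T σ) ∧
      ∀ i, ∀ m ∈ T, embed σ y (σ i m) = σ i (y i m) := by
  have h1 : ∀ i n, (σ i * y i * (σ i)⁻¹) n ≠ n → n ∈ σ i '' T := by
    intro i n hn
    refine ⟨(σ i)⁻¹ n, ?_, by simp⟩
    by_contra h
    apply hn
    rw [Perm.mul_apply, Perm.mul_apply, mem_symOn.1 (hy i) _ h]
    simp
  have h2 : (List.ofFn fun i => σ i * y i * (σ i)⁻¹).Pairwise Perm.Disjoint := by
    rw [List.pairwise_ofFn]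
    intro i j hij n
    by_contra! h
    exact Set.disjoint_left.1 (hσ i j hij.ne) (h1 i n h.1) (h1 j n h.2)
  constructor
  · rw [mem_symOn]
    intro n hn
    by_contra h
    obtain ⟨c, hc, hcn⟩ := exists_mem_of_list_prod_apply_ne h
    obtain ⟨i, rfl⟩ := List.mem_ofFn.1 hc
    obtain ⟨m, hm, rfl⟩ := h1 i n hcn
    exact hn (apply_mem_blockUnion i hm)
  · intro i m hm
    have h3 : (σ i * y i * (σ i)⁻¹) (σ i m) = σ i (y i m) := by simp
    by_cases h : (σ i * y i * (σ i)⁻¹) (σ i m) = σ i m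
    · rw [← h3, h]
      by_contra h4
      obtain ⟨c, hc, hcn⟩ := exists_mem_of_list_prod_apply_ne h4
      obtain ⟨j, rfl⟩ := List.mem_ofFn.1 hc
      obtain ⟨m', hm', h5⟩ := h1 j _ hcn
      obtain ⟨rfl, -⟩ := hσ.eq hm' hm h5
      exact hcn h
    · rw [← h3]
      exact list_prod_apply_of_pairwise_disjoint h2 (List.mem_ofFn.2 ⟨i, rfl⟩) h

theorem DisjointBlocks.embed_injective (hσ : DisjointBlocks T σ) {y y' : Fin s → Perm ℕ}
    (hy : ∀ i, y i ∈ symOn T) (hy' : ∀ i, y' i ∈ symOn T) (h : embed σ y = embed σ y') :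
    y = y' := by
  ext i n
  by_cases hn : n ∈ T
  · apply (σ i).injective
    rw [← (hσ.embed_spec hy).2 i n hn, ← (hσ.embed_spec hy').2 i n hn, h]
  · rw [mem_symOn.1 (hy i) n hn, mem_symOn.1 (hy' i) n hn]

/-- The wreath product of `Q` and `P`, acting on the union of the blocks. -/
def wreathSubgroup {Q : Subgroup (Perm ℕ)} (hQ : Q ≤ symOn T) (σ : Fin s → Perm ℕ)
    (P : Subgroup (Perm (Fin s))) : Subgroup (Perm ℕ) where
  carrier := {g | g ∈ symOn (blockUnion T σ) ∧ ∃ π ∈ P, ∀ i, ∃ u ∈ Q, ∀ m ∈ T,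
    g (σ i m) = σ (π i) (u m)}
  one_mem' := ⟨one_mem _, 1, one_mem _, fun i => ⟨1, one_mem _, fun _ _ => rfl⟩⟩
  mul_mem' := by
    rintro g h ⟨hg, π, hπ, hgπ⟩ ⟨hh, τ, hτ, hhτ⟩
    refine ⟨mul_mem hg hh, π * τ, mul_mem hπ hτ, fun i => ?_⟩
    obtain ⟨u, hu, h1⟩ := hhτ i
    obtain ⟨v, hv, h2⟩ := hgπ (τ i)
    refine ⟨v * u, mul_mem hv hu, fun m hm => ?_⟩
    rw [Perm.mul_apply, h1 m hm, h2 _ ((apply_mem_of_mem_symOn (hQ hu) m).2 hm)]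
    rfl
  inv_mem' := by
    rintro g ⟨hg, π, hπ, hgπ⟩
    refine ⟨inv_mem hg, π⁻¹, inv_mem hπ, fun i => ?_⟩
    obtain ⟨u, hu, h1⟩ := hgπ (π⁻¹ i)
    refine ⟨u⁻¹, inv_mem hu, fun m hm => ?_⟩
    rw [Perm.inv_eq_iff_eq, h1 _ ((apply_mem_of_mem_symOn (hQ (inv_mem hu)) m).2 hm)]
    simp

theorem isPGroup_wreathSubgroup {p : ℕ} {Q : Subgroup (Perm ℕ)} (hQ : Q ≤ symOn T)
    {P : Subgroup (Perm (Fin s))} (hQp : IsPGroup p Q)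
    (hPp : IsPGroup p P) : IsPGroup p (wreathSubgroup hQ σ P) := by
  rintro ⟨g, hg, π, hπ, hgπ⟩
  have h1 : ∀ n : ℕ, ∀ i, ∃ u ∈ Q, ∀ m ∈ T, (g ^ n) (σ i m) = σ ((π ^ n) i) (u m) := by
    intro n
    induction n with
    | zero => exact fun i => ⟨1, one_mem _, fun _ _ => rfl⟩
    | succ n ih =>
      intro i
      obtain ⟨u, hu, h1⟩ := ih i
      obtain ⟨v, hv, h2⟩ := hgπ ((π ^ n) i)
      refine ⟨v * u, mul_mem hv hu, fun m hm => ?_⟩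
      rw [pow_succ', pow_succ', Perm.mul_apply, h1 m hm,
        h2 _ ((apply_mem_of_mem_symOn (hQ hu) m).2 hm)]
      rfl
  obtain ⟨a, ha⟩ := hPp ⟨π, hπ⟩
  have ha' : π ^ p ^ a = 1 := congrArg Subtype.val ha
  choose u hu h2 using h1 (p ^ a)
  choose b hb using fun i => hQp ⟨u i, hu i⟩
  have hb' : ∀ i, u i ^ p ^ b i = 1 := fun i => congrArg Subtype.val (hb i)
  have h3 : ∀ n : ℕ, ∀ i, ∀ m ∈ T, ((g ^ p ^ a) ^ n) (σ i m) = σ i ((u i ^ n) m) := by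
    intro n i
    induction n with
    | zero => exact fun _ _ => rfl
    | succ n ih =>
      intro m hm
      rw [pow_succ', Perm.mul_apply, ih m hm,
        h2 i _ ((apply_mem_of_mem_symOn (pow_mem (hQ (hu i)) n) m).2 hm), ha', pow_succ']
      rfl
  -- The power `g ^ p ^ a` preserves every block and acts on block `i` as `u i`. The sum of the `b
  -- i` serves as a common exponent for all blocks.
  refine ⟨a + ∑ i, b i, Subtype.ext ?_⟩
  change g ^ p ^ (a + ∑ i, b i) = 1
  refine ext_blocks (pow_mem hg _) (one_mem _) fun i m hm => ?_
  rw [pow_add, pow_mul, h3 _ i m hm]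
  have h4 : u i ^ p ^ ∑ i, b i = 1 := by
    rw [← Finset.add_sum_erase _ _ (Finset.mem_univ i), pow_add, pow_mul, hb', one_pow]
  rw [h4]
  rfl

end Blocks

/-- The elements of `*^s Y` whose coordinates are constant on the orbits of `P`. With the trivial
group this is `*^s Y`; with a transitive group it is `Δ^s Y`. -/
def invariantPower (Y : Set (Perm ℕ)) {s : ℕ} (σ : Fin s → Perm ℕ) (P : Subgroup (Perm (Fin s))) :
    Set (Perm ℕ) :=
  {g | ∃ y : Fin s → Perm ℕ, (∀ i, y i ∈ Y) ∧ (∀ π ∈ P, ∀ i, y (π i) = y i) ∧ g = embed σ y}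

section InvariantPower

variable {q : ℕ} {Y : Set (Perm ℕ)} {s : ℕ} {σ : Fin s → Perm ℕ}

theorem IsPlacement.disjointBlocks (hσ : IsPlacement Y σ) : DisjointBlocks (setSupp Y) σ := hσ

theorem supp_embed (hY : Y ∈ familyS q) (hσ : IsPlacement Y σ) {y : Fin s → Perm ℕ}
    (hy : ∀ i, y i ∈ Y) : supp (embed σ y) = blockUnion (setSupp Y) σ ∧
      ∀ n ∈ blockUnion (setSupp Y) σ, minimalPeriod (embed σ y) n = q := by
  have hspec := hσ.disjointBlocks.embed_spec fun i => mem_symOn_of_mem (hy i)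
  constructor
  · ext n
    refine ⟨fun hn => ?_, fun hn => ?_⟩
    · by_contra h
      exact hn (mem_symOn.1 hspec.1 n h)
    · obtain ⟨i, m, hm, rfl⟩ := mem_blockUnion.1 hn
      rw [mem_supp, hspec.2 i m hm, Ne, (σ i).injective.eq_iff, ← Ne, ← mem_supp,
        (hY.2 _ (hy i)).2]
      exact hm
  · intro n hn
    obtain ⟨i, m, hm, rfl⟩ := mem_blockUnion.1 hn
    rw [← minimalPeriod_of_mem_familyS hY (hy i) hm]
    exact minimalPeriod_eq_of_semiconj_on (σ i).injective.injOn
      (fun m hm => (apply_mem_of_mem_symOn (mem_symOn_of_mem (hy i)) m).2 hm)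
      (fun m hm => hspec.2 i m hm) hm

theorem invariantPower_mem_familyS (hY : Y ∈ familyS q) (hσ : IsPlacement Y σ) (hs : 1 ≤ s)
    (P : Subgroup (Perm (Fin s))) : invariantPower Y σ P ∈ familyS q ∧
      setSupp (invariantPower Y σ P) = blockUnion (setSupp Y) σ := by
  obtain ⟨y, hy⟩ := hY.1.2.1
  obtain ⟨m, hm⟩ := setSupp_nonempty hY.1
  refine mem_familyS_of (finite_blockUnion (finite_setSupp hY.1) σ)
    ⟨_, apply_mem_blockUnion ⟨0, hs⟩ hm⟩ ⟨_, fun _ => y, fun _ => hy, fun _ _ _ => rfl, rfl⟩ ?_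
  rintro _ ⟨y, hy, -, rfl⟩
  exact supp_embed hY hσ hy

/-- The `Q`-components commute with each coordinate, and moving block `i` to block `π i` is harmless
because the coordinates are constant on `P`-orbits. -/
theorem wreathSubgroup_le_groupS (hY : Y ∈ familyS q) (hσ : IsPlacement Y σ) (hs : 1 ≤ s)
    {Q : Subgroup (Perm ℕ)} (hQ : Q ≤ groupG Y) (hQY : Q ≤ groupS Y)
    (P : Subgroup (Perm (Fin s))) :
    wreathSubgroup hQ σ P ≤ groupS (invariantPower Y σ P) := by
  rintro g ⟨hg, π, hπ, hgπ⟩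
  refine ⟨?_, ?_⟩
  · change g ∈ symOn _
    rwa [(invariantPower_mem_familyS hY hσ hs P).2]
  · change g ∈ Subgroup.centralizer _
    rw [Subgroup.mem_centralizer_iff]
    rintro _ ⟨y, hy, hyP, rfl⟩
    have hspec := hσ.disjointBlocks.embed_spec fun i => mem_symOn_of_mem (hy i)
    refine ext_blocks (mul_mem hspec.1 hg) (mul_mem hg hspec.1) fun i m hm => ?_
    obtain ⟨u, hu, h1⟩ := hgπ i
    have hcomm := Perm.congr_fun (Subgroup.mem_centralizer_iff.1 (hQY hu).2 (y i) (hy i)) m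
    rw [Perm.mul_apply, Perm.mul_apply, h1 m hm,
      hspec.2 _ _ ((apply_mem_of_mem_symOn (hQ hu) m).2 hm), hspec.2 i m hm,
      h1 _ ((apply_mem_of_mem_symOn (mem_symOn_of_mem (hy i)) m).2 hm), hyP π hπ]
    exact congrArg _ hcomm

/-- Commuting with copies of `Q` on single blocks forces `ξ` to preserve the blocks and its
coordinates to lie in `Y`. Commuting with the block permutations from `P` makes the coordinates
constant on `P`-orbits. -/
theorem mem_invariantPower_of_commute (hq : 2 ≤ q) (hY : Y ∈ familyS q) (hσ : IsPlacement Y σ)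
    (hs : 1 ≤ s) {Q : Subgroup (Perm ℕ)} (hQ : Q ≤ groupG Y)
    (hfree : ∀ m ∈ setSupp Y, ∃ u ∈ Q, u m ≠ m)
    (hfix : ∀ ξ ∈ Xi Y, (∀ u ∈ Q, u * ξ * u⁻¹ = ξ) → ξ ∈ Y) (P : Subgroup (Perm (Fin s)))
    {ξ : Perm ℕ} (hξ : ξ ∈ Xi (invariantPower Y σ P))
    (hcomm : ∀ u ∈ wreathSubgroup hQ σ P, u * ξ * u⁻¹ = ξ) : ξ ∈ invariantPower Y σ P := by
  have hW := invariantPower_mem_familyS hY hσ hs P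
  rw [mem_Xi_iff hq hW.1, hW.2] at hξ
  obtain ⟨hsupp, hper⟩ := hξ
  have hd := hσ.disjointBlocks
  have hξU : ∀ n, ξ n ∈ blockUnion (setSupp Y) σ ↔ n ∈ blockUnion (setSupp Y) σ := by
    rw [← hsupp]
    exact apply_mem_supp ξ
  have hξsym : ξ ∈ symOn (blockUnion (setSupp Y) σ) := by
    refine mem_symOn.2 fun n hn => ?_
    by_contra h
    exact hn (hsupp ▸ h)
  have hcomm' : ∀ g ∈ wreathSubgroup hQ σ P, ∀ n, g (ξ n) = ξ (g n) := fun g hg n => by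
    have := hcomm g hg
    rw [mul_inv_eq_iff_eq_mul] at this
    exact Perm.congr_fun this n
  have hsingle : ∀ j, ∀ u ∈ Q, ∃ g ∈ wreathSubgroup hQ σ P,
      (∀ m ∈ setSupp Y, g (σ j m) = σ j (u m)) ∧
      ∀ i ≠ j, ∀ m ∈ setSupp Y, g (σ i m) = σ i m := by
    intro j u hu
    have hu' : ∀ i, (Pi.mulSingle j u : Fin s → Perm ℕ) i ∈ Q := by
      intro i
      by_cases hij : i = j
      · subst hij
        simpa using hu
      · rw [Pi.mulSingle_eq_of_ne hij]
        exact one_mem _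
    obtain ⟨g, hg, hgσ⟩ := hd.exists_glue 1 (Pi.mulSingle j u) fun i => hQ (hu' i)
    refine ⟨g, ⟨hg, 1, one_mem _, fun i => ⟨_, hu' i, hgσ i⟩⟩, fun m hm => ?_, fun i hij m hm => ?_⟩
    · simpa using hgσ j m hm
    · rw [hgσ i m hm, Pi.mulSingle_eq_of_ne hij]
      rfl
  have hblock : ∀ i, ∀ m ∈ setSupp Y, ∃ m' ∈ setSupp Y, ξ (σ i m) = σ i m' := by
    intro i m hm
    obtain ⟨j, m', hm', h⟩ := mem_blockUnion.1 ((hξU _).2 (apply_mem_blockUnion i hm))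
    by_cases hij : i = j
    · subst hij
      exact ⟨m', hm', h.symm⟩
    -- If `ξ` sent a point of block `i` into another block `j`, some element of `Q` acting on block
    -- `j` alone would move the image but not the point. This uses that `Q` has no fixed point on
    -- the support.
    · obtain ⟨u, hu, hum⟩ := hfree m' hm'
      obtain ⟨g, hg, hg1, hg2⟩ := hsingle j u hu
      have h1 := hcomm' g hg (σ i m)
      rw [hg2 i hij m hm, ← h, hg1 m' hm'] at h1
      exact (hum ((σ j).injective h1)).elim
  have hy : ∀ i, ∃ y ∈ groupG Y, ∀ m ∈ setSupp Y, ξ (σ i m) = σ i (y m) := by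
    intro i
    obtain ⟨y, hy, h⟩ := exists_mem_symOn_eqOn (T := setSupp Y) (g := (σ i)⁻¹ * ξ * σ i) (by
      intro n
      rw [Perm.mul_apply, Perm.mul_apply]
      constructor
      · intro h
        obtain ⟨j, m, hm, hn⟩ := mem_blockUnion.1 ((hξU _).1
          (by simpa using apply_mem_blockUnion (σ := σ) i h))
        obtain ⟨m', hm', h2⟩ := hblock j m hm
        obtain ⟨rfl, -⟩ := hd.eq (i := i) (j := j) h hm' (by rw [← h2, hn]; simp)
        rwa [← (σ i).injective hn]
      · intro h
        obtain ⟨m', hm', h2⟩ := hblock i n h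
        rw [h2]
        simpa using hm')
    refine ⟨y, hy, fun m hm => ?_⟩
    rw [h m hm]
    simp
  choose y hyG hξy using hy
  have hyY : ∀ i, y i ∈ Y := by
    intro i
    refine hfix _ ((mem_Xi_iff hq hY).2 ⟨?_, fun m hm => ?_⟩) fun u hu => ?_
    · ext m
      refine ⟨fun h => ?_, fun h => ?_⟩
      · by_contra h'
        exact h (mem_symOn.1 (hyG i) m h')
      · have h1 : σ i m ∈ supp ξ := hsupp ▸ apply_mem_blockUnion i h
        rw [mem_supp, hξy i m h] at h1
        exact fun h2 => h1 (by rw [h2])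
    · rw [← hper _ (apply_mem_blockUnion i hm)]
      exact (minimalPeriod_eq_of_semiconj_on (σ i).injective.injOn
        (fun m hm => (apply_mem_of_mem_symOn (hyG i) m).2 hm) (fun m hm => hξy i m hm) hm).symm
    · obtain ⟨g, hg, hg1, -⟩ := hsingle i u hu
      rw [mul_inv_eq_iff_eq_mul]
      ext m
      by_cases hm : m ∈ setSupp Y
      · have h1 := hcomm' g hg (σ i m)
        have h2 := (apply_mem_of_mem_symOn (hyG i) m).2 hm
        have h3 := (apply_mem_of_mem_symOn (hQ hu) m).2 hm
        rw [hξy i m hm, hg1 _ h2, hg1 m hm, hξy i _ h3] at h1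
        exact (σ i).injective h1
      · have h1 := mem_symOn.1 (hyG i) m hm
        have h2 := mem_symOn.1 (hQ hu) m hm
        rw [Perm.mul_apply, Perm.mul_apply, h1, h2, h1]
  have hspec := hd.embed_spec hyG
  refine ⟨y, hyY, fun π hπ i => ?_, ?_⟩
  · obtain ⟨g, hg, hgσ⟩ := hd.exists_glue π (fun _ => 1) fun _ => one_mem _
    ext m
    by_cases hm : m ∈ setSupp Y
    · have h1 := hcomm' g ⟨hg, π, hπ, fun i => ⟨1, one_mem _, hgσ i⟩⟩ (σ i m)
      have h2 := (apply_mem_of_mem_symOn (hyG i) m).2 hm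
      rw [hξy i m hm, hgσ i _ h2, hgσ i m hm, Perm.one_apply, Perm.one_apply,
        hξy (π i) m hm] at h1
      exact ((σ (π i)).injective h1).symm
    · rw [mem_symOn.1 (hyG _) m hm, mem_symOn.1 (hyG _) m hm]
  · exact ext_blocks hξsym hspec.1 fun i m hm => by rw [hξy i m hm, hspec.2 i m hm]

variable {k : Type*} [Field k] {p : ℕ} [Fact p.Prime] [CharP k p]

theorem isFixedPointSet_invariantPower (hq : 2 ≤ q) (hY : Y ∈ familyS q) (hσ : IsPlacement Y σ)
    (hs : 1 ≤ s) (hYexact : IsExact p Y) (hYfix : IsFixedPointSet k Y)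
    {P : Subgroup (Perm (Fin s))} (hP : IsPGroup p P) [Finite Y] [Finite (invariantPower Y σ P)]
    (hproj : HasProjectiveIdempotent k (conjPerms Y) →
      HasProjectiveIdempotent k (conjPerms (invariantPower Y σ P))) :
    IsFixedPointSet k (invariantPower Y σ P) := by
  obtain ⟨Q, hQS, hQ, hindex, hfix, _, hproj'⟩ :=
    IsFixedPointSet.exists_subgroup (p := p) hY.1 hYfix
  have hQG : Q ≤ groupG Y := fun u hu => (hQS hu).1
  exact isFixedPointSet_of_subgroup (p := p) (invariantPower_mem_familyS hY hσ hs P).1.1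
    (wreathSubgroup_le_groupS hY hσ hs hQG hQS P)
    (isPGroup_wreathSubgroup hQG hQ hP)
    (fun ξ hξ => mem_invariantPower_of_commute hq hY hσ hs hQG
      (fun m hm => hYexact.exists_apply_ne hQ hindex hm) hfix P hξ) (hproj hproj')

end InvariantPower

end FixedPointSets

/-! ### Irreducibility, and the normalizer of the star power. -/

namespace FixedPointSets

open Equiv Function

theorem apply_mem_iff_of_finite {V : Set ℕ} (hV : V.Finite) {g : Perm ℕ}
    (hg : ∀ n, n ∈ V → g n ∈ V) (n : ℕ) : g n ∈ V ↔ n ∈ V := by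
  refine ⟨fun h => ?_, hg n⟩
  have h1 : g '' V = V := Set.eq_of_subset_of_ncard_le (Set.image_subset_iff.2 hg)
    (Set.ncard_image_of_injective V g.injective).ge hV
  rw [← h1] at h
  obtain ⟨m, hm, hmn⟩ := h
  rwa [← g.injective hmn]

section Irreducible

variable {q : ℕ} {X : Set (Perm ℕ)}

/-- If `V` were proper and nonempty, the restrictions of `X` to `V` and to its complement in the
support would be factors of `X`; the gluing hypothesis puts every product of the two back in `X`. -/
theorem IsIrreducibleSet.eq_empty_or_eq (hX : X ∈ familyS q) (hirr : IsIrreducibleSet X)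
    {V : Set ℕ} (hVT : V ⊆ setSupp X) (hV : ∀ x ∈ X, ∀ n, x n ∈ V ↔ n ∈ V)
    (hglue : ∀ x ∈ X, ∀ x' ∈ X, ∃ x'' ∈ X, (∀ n ∈ V, x'' n = x n) ∧
      ∀ n ∈ setSupp X, n ∉ V → x'' n = x' n) : V = ∅ ∨ V = setSupp X := by
  by_contra! h
  apply hirr
  have hT := finite_setSupp hX.1
  have key : ∀ V' : Set ℕ, V' ⊆ setSupp X → V'.Nonempty → (∀ x ∈ X, ∀ n, x n ∈ V' ↔ n ∈ V') →
      {a | a ∈ symOn V' ∧ ∃ x ∈ X, ∀ n ∈ V', a n = x n} ∈ familyF ∧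
      setSupp {a | a ∈ symOn V' ∧ ∃ x ∈ X, ∀ n ∈ V', a n = x n} ⊆ V' := by
    intro V' hV' hne hpres
    have hsub : ∀ a ∈ symOn V', supp a ⊆ V' := by
      intro a ha n hn
      by_contra h
      exact hn (mem_symOn.1 ha n h)
    have hfin := finite_symOn (hT.subset hV')
    obtain ⟨x, hx⟩ := hX.1.2.1
    obtain ⟨a, ha, hax⟩ := exists_mem_symOn_eqOn (hpres x hx)
    refine ⟨⟨(Set.toFinite (symOn V' : Set (Perm ℕ))).subset fun a ha => ha.1,
      ⟨a, ha, x, hx, hax⟩, fun h => ?_, fun a ha => (hT.subset hV').subset (hsub a ha.1)⟩,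
      Set.iUnion₂_subset fun a ha => hsub a ha.1⟩
    have h1 : a = 1 := by
      rw [← Set.mem_singleton_iff, ← h]
      exact ⟨ha, x, hx, hax⟩
    obtain ⟨n, hn⟩ := hne
    have h2 : n ∈ supp x := by
      rw [(hX.2 x hx).2]
      exact hV' hn
    rw [mem_supp, ← hax n hn, h1] at h2
    exact h2 rfl
  have hpres' : ∀ x ∈ X, ∀ n, x n ∈ setSupp X \ V ↔ n ∈ setSupp X \ V := by
    intro x hx n
    rw [Set.mem_sdiff, Set.mem_sdiff, hV x hx, apply_mem_of_mem_symOn (mem_symOn_of_mem hx)]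
  have hne' : (setSupp X \ V).Nonempty := by
    rw [Set.nonempty_iff_ne_empty, Ne, Set.sdiff_eq_empty]
    exact fun h1 => h.2 (hVT.antisymm h1)
  have h1 := key V hVT h.1 hV
  have h2 := key (setSupp X \ V) Set.sdiff_subset hne' hpres'
  have hprod : ∀ a ∈ symOn V, ∀ b ∈ symOn (setSupp X \ V), ∀ x ∈ X, (∀ n ∈ V, a n = x n) →
      (∀ n ∈ setSupp X \ V, b n = x n) → x = a * b := by
    intro a ha b hb x hx hax hbx
    ext n
    rw [Perm.mul_apply]
    by_cases hn : n ∈ V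
    · rw [mem_symOn.1 hb n fun h => h.2 hn, hax n hn]
    · by_cases hnT : n ∈ setSupp X
      · rw [hbx n ⟨hnT, hn⟩, mem_symOn.1 ha]
        rwa [hV x hx]
      · rw [mem_symOn.1 hb n fun h => hnT h.1, mem_symOn.1 ha n hn,
          mem_symOn.1 (mem_symOn_of_mem hx) n hnT]
  refine ⟨_, h1.1, _, h2.1, (Set.disjoint_sdiff_right.mono_left h1.2).mono_right h2.2, ?_⟩
  ext x
  constructor
  · intro hx
    obtain ⟨a, ha, hax⟩ := exists_mem_symOn_eqOn (hV x hx)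
    obtain ⟨b, hb, hbx⟩ := exists_mem_symOn_eqOn (hpres' x hx)
    exact ⟨a, ⟨ha, x, hx, hax⟩, b, ⟨hb, x, hx, hbx⟩, hprod a ha b hb x hx hax hbx⟩
  · rintro ⟨a, ⟨ha, x, hx, hax⟩, b, ⟨hb, x', hx', hbx⟩, rfl⟩
    obtain ⟨x'', hx'', h3, h4⟩ := hglue x hx x' hx'
    rw [← hprod a ha b hb x'' hx'' (fun n hn => by rw [h3 n hn, hax n hn])
      fun n hn => by rw [h4 n hn.1 hn.2, hbx n hn]]
    exact hx''

/-- The converse of the preceding principle: the support of one factor serves as `V`, and gluing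
recombines a factor of one element with the complementary factor of another. -/
theorem exists_of_not_isIrreducibleSet (hirr : ¬ IsIrreducibleSet X) :
    ∃ V ⊆ setSupp X, V.Nonempty ∧ (setSupp X \ V).Nonempty ∧ (∀ x ∈ X, ∀ n, x n ∈ V ↔ n ∈ V) ∧
      ∀ x ∈ X, ∀ x' ∈ X, ∃ x'' ∈ X, (∀ n ∈ V, x'' n = x n) ∧ ∀ n ∉ V, x'' n = x' n := by
  obtain ⟨A, hA, B, hB, hAB, rfl⟩ := not_not.1 hirr
  have ha : ∀ a ∈ A, a ∈ symOn (setSupp A) := fun a ha => mem_symOn_of_mem ha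
  have hb : ∀ b ∈ B, ∀ n ∈ setSupp A, b n = n := fun b hb n hn =>
    mem_symOn.1 (mem_symOn_of_mem hb) n (Set.disjoint_left.1 hAB hn)
  have hb' : ∀ b ∈ B, ∀ n, b n ∈ setSupp A ↔ n ∈ setSupp A := by
    intro b hbB n
    have := apply_mem_of_mem_symOn (T := (setSupp A)ᶜ) (g := b)
      (mem_symOn.2 fun n hn => hb b hbB n (not_not.1 hn)) n
    simpa [not_iff_not] using this
  obtain ⟨a₀, ha₀⟩ := hA.2.1
  obtain ⟨b₀, hb₀⟩ := hB.2.1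
  refine ⟨setSupp A, fun n hn => ?_, setSupp_nonempty hA, ?_, ?_, ?_⟩
  · simp only [setSupp, Set.mem_iUnion] at hn
    obtain ⟨a, haA, hn⟩ := hn
    refine supp_subset_setSupp (X := {g | ∃ y ∈ A, ∃ z ∈ B, g = y * z}) (ρ := a * b₀)
      ⟨a, haA, b₀, hb₀, rfl⟩ ?_
    rw [mem_supp, Perm.mul_apply, hb b₀ hb₀ n (supp_subset_setSupp haA hn)]
    exact hn
  · obtain ⟨n, hn⟩ := setSupp_nonempty hB
    have hnA := Set.disjoint_right.1 hAB hn
    refine ⟨n, ?_, hnA⟩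
    simp only [setSupp, Set.mem_iUnion] at hn
    obtain ⟨b, hbB, hn⟩ := hn
    refine supp_subset_setSupp (X := {g | ∃ y ∈ A, ∃ z ∈ B, g = y * z}) (ρ := a₀ * b)
      ⟨a₀, ha₀, b, hbB, rfl⟩ ?_
    rw [mem_supp, Perm.mul_apply, mem_symOn.1 (ha a₀ ha₀)]
    · exact hn
    · rwa [hb' b hbB]
  · rintro _ ⟨a, haA, b, hbB, rfl⟩ n
    rw [Perm.mul_apply, apply_mem_of_mem_symOn (ha a haA), hb' b hbB]
  · rintro _ ⟨a, haA, b, hbB, rfl⟩ _ ⟨a', haA', b', hbB', rfl⟩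
    refine ⟨a * b', ⟨a, haA, b', hbB', rfl⟩, fun n hn => ?_, fun n hn => ?_⟩
    · rw [Perm.mul_apply, Perm.mul_apply, hb b hbB n hn, hb b' hbB' n hn]
    · have h1 : b' n ∉ setSupp A := by rwa [hb' b' hbB']
      rw [Perm.mul_apply, Perm.mul_apply, mem_symOn.1 (ha a haA) _ h1,
        mem_symOn.1 (ha a' haA') _ h1]

end Irreducible

section Powers

variable {q : ℕ} {Y : Set (Perm ℕ)} {s : ℕ} {σ : Fin s → Perm ℕ}

theorem starPower_eq_invariantPower : starPower Y σ = invariantPower Y σ ⊥ := by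
  ext g
  refine exists_congr fun y => and_congr_right fun _ => ?_
  refine ⟨fun h => ⟨fun π hπ i => ?_, h⟩, fun h => h.2⟩
  rw [Subgroup.mem_bot.1 hπ]
  rfl

/-- An element that normalizes `*^s Y` permutes the blocks, when `Y` is irreducible. -/
theorem exists_block_perm (hY : Y ∈ familyS q) (hirr : IsIrreducibleSet Y) (hσ : IsPlacement Y σ)
    {g : Perm ℕ} (hg : g ∈ symOn (blockUnion (setSupp Y) σ))
    (h1 : ∀ w ∈ starPower Y σ, g * w * g⁻¹ ∈ starPower Y σ)
    (h2 : ∀ w ∈ starPower Y σ, g⁻¹ * w * g ∈ starPower Y σ) :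
    ∃ (π : Perm (Fin s)) (h : Fin s → Perm ℕ), (∀ i, h i ∈ groupG Y) ∧
      ∀ i, ∀ m ∈ setSupp Y, g (σ (π i) m) = σ i (h i m) := by
  have hd := hσ.disjointBlocks
  have hspec : ∀ {y : Fin s → Perm ℕ}, (∀ i, y i ∈ Y) → _ := fun {y} hy =>
    hd.embed_spec fun i => mem_symOn_of_mem (hy i)
  have hmem : ∀ y ∈ Y, ∀ m, y m ∈ setSupp Y ↔ m ∈ setSupp Y := fun y hy =>
    apply_mem_of_mem_symOn (mem_symOn_of_mem hy)
  have hblock : ∀ i j, (∃ m ∈ setSupp Y, ∃ m' ∈ setSupp Y, g⁻¹ (σ i m) = σ j m') →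
      ∀ m ∈ setSupp Y, ∃ m' ∈ setSupp Y, g⁻¹ (σ i m) = σ j m' := by
    rintro i j ⟨m₀, hm₀, hm₀'⟩
    -- The points of block `i` that `g⁻¹` sends into block `j`. Irreducibility of `Y` will show that
    -- they are none or all of the block.
    set V : Set ℕ := {m | m ∈ setSupp Y ∧ ∃ m' ∈ setSupp Y, g⁻¹ (σ i m) = σ j m'} with hV
    have hpres : ∀ y ∈ Y, ∀ n, n ∈ V → y n ∈ V := by
      rintro y hy n ⟨hn, m', hm', hnm'⟩
      refine ⟨(hmem y hy n).2 hn, ?_⟩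
      obtain ⟨a, ha, hga⟩ := h2 (embed σ fun _ => y) ⟨_, fun _ => hy, rfl⟩
      refine ⟨a j m', (hmem _ (ha j) _).2 hm', ?_⟩
      rw [← (hspec ha).2 j m' hm', ← hga, ← hnm', Perm.mul_apply, Perm.mul_apply,
        show g (g⁻¹ (σ i n)) = σ i n from g.apply_symm_apply _, (hspec fun _ => hy).2 i n hn]
    have hVfin : V.Finite := (finite_setSupp hY.1).subset fun m hm => hm.1
    have hor : V = ∅ ∨ V = setSupp Y := by
      refine hirr.eq_empty_or_eq hY (fun m hm => hm.1)
        (fun y hy => apply_mem_iff_of_finite hVfin (hpres y hy)) ?_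
      intro y hy y' hy'
      obtain ⟨a, ha, hga⟩ := h2 (embed σ fun _ => y) ⟨_, fun _ => hy, rfl⟩
      obtain ⟨a', ha', hga'⟩ := h2 (embed σ fun _ => y') ⟨_, fun _ => hy', rfl⟩
      -- Gluing happens on the other side of the conjugation. Coordinate `j` comes from the
      -- conjugate of `y` and the others from that of `y'`; conjugating back gives coordinate `i`
      -- equal to `y` on `V` and to `y'` off it.
      have hc : ∀ l, Function.update a' j (a j) l ∈ Y := by
        intro l
        by_cases hl : l = j
        · subst hl
          simpa using ha l
        · rw [Function.update_of_ne hl]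
          exact ha' l
      obtain ⟨b, hb, hgb⟩ := h1 (embed σ (Function.update a' j (a j))) ⟨_, hc, rfl⟩
      refine ⟨b i, hb i, ?_, ?_⟩
      · rintro m ⟨hm, m', hm', hmm'⟩
        apply (σ i).injective
        rw [← (hspec hb).2 i m hm, ← hgb, ← (hspec fun _ => hy).2 i m hm, Perm.mul_apply,
          Perm.mul_apply, hmm', (hspec hc).2 j m' hm', Function.update_self,
          ← (hspec ha).2 j m' hm', ← hga, ← hmm']
        simp
      · intro m hm hmV
        obtain ⟨l, m', hm', hmm'⟩ := mem_blockUnion.1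
          ((apply_mem_of_mem_symOn (inv_mem hg) _).2 (apply_mem_blockUnion (σ := σ) i hm))
        have hl : l ≠ j := by
          rintro rfl
          exact hmV ⟨hm, m', hm', hmm'.symm⟩
        apply (σ i).injective
        rw [← (hspec hb).2 i m hm, ← hgb, ← (hspec fun _ => hy').2 i m hm, Perm.mul_apply,
          Perm.mul_apply, ← hmm', (hspec hc).2 l m' hm', Function.update_of_ne hl,
          ← (hspec ha').2 l m' hm', ← hga', hmm']
        simp
    rcases hor with h | h
    · exact (Set.notMem_empty m₀ (h ▸ ⟨hm₀, hm₀'⟩)).elim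
    · intro m hm
      rw [← h] at hm
      exact hm.2
  have hj : ∀ i, ∃ j, ∀ m ∈ setSupp Y, ∃ m' ∈ setSupp Y, g⁻¹ (σ i m) = σ j m' := by
    intro i
    obtain ⟨m, hm⟩ := setSupp_nonempty hY.1
    obtain ⟨j, m', hm', hmm'⟩ := mem_blockUnion.1
      ((apply_mem_of_mem_symOn (inv_mem hg) _).2 (apply_mem_blockUnion (σ := σ) i hm))
    exact ⟨j, hblock i j ⟨m, hm, m', hm', hmm'.symm⟩⟩
  choose j hj using hj
  have hc : ∀ i, ∃ c ∈ groupG Y, ∀ m ∈ setSupp Y, g⁻¹ (σ i m) = σ (j i) (c m) := by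
    intro i
    have hmaps : ∀ m, m ∈ setSupp Y → ((σ (j i))⁻¹ * g⁻¹ * σ i) m ∈ setSupp Y := by
      intro m hm
      obtain ⟨m', hm', h⟩ := hj i m hm
      rw [Perm.mul_apply, Perm.mul_apply, h]
      simpa using hm'
    obtain ⟨c, hc, h⟩ := exists_mem_symOn_eqOn (T := setSupp Y)
      (g := (σ (j i))⁻¹ * g⁻¹ * σ i) (apply_mem_iff_of_finite (finite_setSupp hY.1) hmaps)
    refine ⟨c, hc, fun m hm => ?_⟩
    rw [h m hm]
    simp
  choose c hcG hc using hc
  have hc' : ∀ i, ∀ m ∈ setSupp Y, g (σ (j i) m) = σ i ((c i)⁻¹ m) := by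
    intro i m hm
    have := hc i ((c i)⁻¹ m) ((apply_mem_of_mem_symOn (inv_mem (hcG i)) m).2 hm)
    rw [show c i ((c i)⁻¹ m) = m from (c i).apply_symm_apply m, Perm.inv_eq_iff_eq] at this
    exact this.symm
  have hinj : Function.Injective j := by
    intro i i' hii'
    obtain ⟨m, hm⟩ := setSupp_nonempty hY.1
    have h3 := hc' i m hm
    rw [hii', hc' i' m hm] at h3
    exact (hd.eq ((apply_mem_of_mem_symOn (inv_mem (hcG i')) m).2 hm)
      ((apply_mem_of_mem_symOn (inv_mem (hcG i)) m).2 hm) h3).1.symm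
  exact ⟨Equiv.ofBijective j (Finite.injective_iff_bijective.1 hinj), fun i => (c i)⁻¹,
    fun i => inv_mem (hcG i), hc'⟩

variable {k : Type*} [Field k] {p : ℕ} [Fact p.Prime] [CharP k p]

/-- By `exists_block_perm`, a permutation induced on `Y^s` permutes the coordinates and conjugates
each within `Y`. It therefore lies in the wreath product treated by
`HasProjectiveIdempotent.of_wreath`. -/
theorem hasProjectiveIdempotent_starPower (hY : Y ∈ familyS q) (hirr : IsIrreducibleSet Y)
    (hσ : IsPlacement Y σ) (hs : 1 ≤ s) (hsp : s < p) [Finite Y] [Finite (starPower Y σ)]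
    (h : HasProjectiveIdempotent k (conjPerms Y)) :
    HasProjectiveIdempotent k (conjPerms (starPower Y σ)) := by
  have hd := hσ.disjointBlocks
  have hspec : ∀ {y : Fin s → Perm ℕ}, (∀ i, y i ∈ Y) → _ := fun {y} hy =>
    hd.embed_spec fun i => mem_symOn_of_mem (hy i)
  have hmem : ∀ y ∈ Y, ∀ m, y m ∈ setSupp Y ↔ m ∈ setSupp Y := fun y hy =>
    apply_mem_of_mem_symOn (mem_symOn_of_mem hy)
  let ε : (Fin s → Y) ≃ starPower Y σ := Equiv.ofBijective
    (fun y => ⟨embed σ fun i => (y i : Perm ℕ), _, fun i => (y i).2, rfl⟩) (by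
      constructor
      · intro y y' h
        have := hd.embed_injective (fun i => mem_symOn_of_mem (y i).2)
          (fun i => mem_symOn_of_mem (y' i).2) (congrArg Subtype.val h)
        ext1 i
        exact Subtype.ext (congrFun this i)
      · rintro ⟨_, y, hy, rfl⟩
        exact ⟨fun i => ⟨y i, hy i⟩, rfl⟩)
  refine h.of_wreath hsp ε ?_
  rintro γ ⟨g, hg, hgγ⟩
  have hsupp : setSupp (starPower Y σ) = blockUnion (setSupp Y) σ := by
    rw [starPower_eq_invariantPower]
    exact (invariantPower_mem_familyS hY hσ hs ⊥).2
  have hgU : g ∈ symOn (blockUnion (setSupp Y) σ) := hsupp ▸ hg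
  have h1 : ∀ w ∈ starPower Y σ, g * w * g⁻¹ ∈ starPower Y σ := fun w hw => by
    rw [hgγ ⟨w, hw⟩]
    exact Subtype.property _
  have h2 : ∀ w ∈ starPower Y σ, g⁻¹ * w * g ∈ starPower Y σ := fun w hw => by
    have h3 := hgγ (γ.symm ⟨w, hw⟩)
    rw [Equiv.apply_symm_apply] at h3
    rw [← show g * (γ.symm ⟨w, hw⟩ : Perm ℕ) * g⁻¹ = w from h3]
    convert Subtype.property (γ.symm ⟨w, hw⟩) using 1
    group
  obtain ⟨π, c, hc, hgc⟩ := exists_block_perm hY hirr hσ hgU h1 h2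
  have hginv : ∀ i, ∀ m ∈ setSupp Y, g⁻¹ (σ i m) = σ (π i) ((c i)⁻¹ m) := by
    intro i m hm
    rw [Perm.inv_eq_iff_eq, hgc i _ ((apply_mem_of_mem_symOn (inv_mem (hc i)) m).2 hm),
      show c i ((c i)⁻¹ m) = m from (c i).apply_symm_apply m]
  have hconj : ∀ y : Fin s → Perm ℕ, (∀ i, y i ∈ Y) →
      g * embed σ y * g⁻¹ = embed σ fun i => c i * y (π i) * (c i)⁻¹ := by
    intro y hy
    have hspec' := hd.embed_spec (y := fun i => c i * y (π i) * (c i)⁻¹) fun i =>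
      mul_mem (mul_mem (hc i) (mem_symOn_of_mem (hy _))) (inv_mem (hc i))
    refine ext_blocks (mul_mem (mul_mem hgU (hspec hy).1) (inv_mem hgU)) hspec'.1 fun i m hm => ?_
    have hm' := (apply_mem_of_mem_symOn (inv_mem (hc i)) m).2 hm
    rw [hspec'.2 i m hm, Perm.mul_apply, Perm.mul_apply, hginv i m hm, (hspec hy).2 _ _ hm',
      hgc _ _ ((hmem _ (hy _) _).2 hm')]
    rfl
  have hcY : ∀ i, ∀ y ∈ Y, c i * y * (c i)⁻¹ ∈ Y := by
    intro i y hy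
    obtain ⟨b, hb, h3⟩ := h1 (embed σ fun _ => y) ⟨_, fun _ => hy, rfl⟩
    rw [hconj _ fun _ => hy] at h3
    have := hd.embed_injective (fun i => mul_mem (mul_mem (hc i) (mem_symOn_of_mem hy))
      (inv_mem (hc i))) (fun i => mem_symOn_of_mem (hb i)) h3
    rw [congrFun this i]
    exact hb i
  have hinj : ∀ i, Function.Injective fun y : Y => (⟨c i * y * (c i)⁻¹, hcY i y y.2⟩ : Y) := by
    intro i y y' h
    exact Subtype.ext (mul_left_cancel (mul_right_cancel (congrArg Subtype.val h)))
  refine ⟨fun i => Equiv.ofBijective _ (Finite.injective_iff_bijective.1 (hinj i)), π,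
    fun i => ⟨c i, hc i, fun _ => rfl⟩, fun y => Subtype.ext ?_⟩
  rw [← hgγ]
  exact hconj _ fun i => (y i).2

end Powers

end FixedPointSets

/-! ### Cancellation for finite sets with a group action. -/

namespace FixedPointSets

/-- Finite `F`-sets can be cancelled: `n` copies of `A` are isomorphic to `n` copies of `B` only if
`A` and `B` are isomorphic. -/
theorem exists_equivariant_equiv_of_prod {F A B : Type*} [Group F] [Finite A] [Finite B]
    (f₁ : F →* Equiv.Perm A) (f₂ : F →* Equiv.Perm B) {n : ℕ} (hn : 0 < n)
    (φ : Fin n × A ≃ Fin n × B)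
    (hφ : ∀ w i a, φ (i, f₁ w a) = ((φ (i, a)).1, f₂ w (φ (i, a)).2)) :
    ∃ e : A ≃ B, ∀ w a, e (f₁ w a) = f₂ w (e a) := by
  classical
  have := Fintype.ofFinite A
  have := Fintype.ofFinite B
  let _ : MulAction F A := MulAction.compHom A f₁
  let _ : MulAction F B := MulAction.compHom B f₂
  let OA := MulAction.orbitRel.Quotient F A
  let OB := MulAction.orbitRel.Quotient F B
  have := Fintype.ofFinite OB
  let mkA : A → OA := Quotient.mk''
  let mkB : B → OB := Quotient.mk''
  have hmkA : ∀ a a', mkA a = mkA a' ↔ ∃ w, f₁ w a' = a := fun a a' =>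
    Quotient.eq''.trans MulAction.orbitRel_apply
  have hmkB : ∀ b b', mkB b = mkB b' ↔ ∃ w, f₂ w b' = b := fun b b' =>
    Quotient.eq''.trans MulAction.orbitRel_apply
  have hout : ∀ o : OA, mkA o.out = o := fun o => Quotient.out_eq' o
  -- The orbit `o` embeds equivariantly in `o'`. The map `ψ` is defined on all of `A`, but only its
  -- values on `o` matter.
  let Emb : OA → OB → Prop := fun o o' => ∃ ψ : A → B, ∀ a, mkA a = o →
    (∀ w, ψ (f₁ w a) = f₂ w (ψ a)) ∧ mkB (ψ a) = o' ∧ ∀ a', mkA a' = o → ψ a = ψ a' → a = a'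
  let t : OA → Finset OB := fun o => Finset.univ.filter (Emb o)
  have hφ1 : ∀ i a a', mkA a = mkA a' → (φ (i, a)).1 = (φ (i, a')).1 := by
    intro i a a' h
    obtain ⟨w, rfl⟩ := (hmkA _ _).1 h
    rw [hφ]
  have hEmb : ∀ i (o : OA), Emb o (mkB (φ (i, o.out)).2) := by
    intro i o
    refine ⟨fun a => (φ (i, a)).2, fun a ha => ⟨fun w => by simp only [hφ], ?_, fun a' ha' h => ?_⟩⟩
    · obtain ⟨w, hw⟩ := (hmkA a o.out).1 (ha.trans (hout o).symm)
      rw [hmkB]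
      exact ⟨w, by simp only [← hw, hφ]⟩
    · have := φ.injective (Prod.ext (hφ1 i a a' (ha.trans ha'.symm)) h)
      exact congrArg Prod.snd this
  -- Hall's marriage theorem matches orbits. Its counting condition is checked after multiplication
  -- by `n`, where `φ` injects pairs of an index and an orbit of `A` into such pairs for `B`.
  obtain ⟨f, hf, hft⟩ := (Finset.all_card_le_biUnion_card_iff_exists_injective t).1 (by
    intro S
    refine Nat.le_of_mul_le_mul_left ?_ hn
    have h1 : (Finset.univ ×ˢ S : Finset (Fin n × OA)).card ≤
        (Finset.univ ×ˢ S.biUnion t : Finset (Fin n × OB)).card := by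
      refine Finset.card_le_card_of_injOn
        (fun x => ((φ (x.1, x.2.out)).1, mkB (φ (x.1, x.2.out)).2)) ?_ ?_
      · rintro ⟨i, o⟩ ho
        simp only [Finset.coe_product, Set.mem_prod, Finset.mem_coe] at ho ⊢
        exact ⟨Finset.mem_univ _, Finset.mem_biUnion.2 ⟨o, ho.2,
          Finset.mem_filter.2 ⟨Finset.mem_univ _, hEmb i o⟩⟩⟩
      · rintro ⟨i, o⟩ - ⟨i', o'⟩ - h
        simp only [Prod.mk.injEq] at h
        obtain ⟨w, hw⟩ := (hmkB _ _).1 h.2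
        have h2 : φ (i, o.out) = φ (i', f₁ w o'.out) := by
          rw [hφ]
          exact Prod.ext h.1 hw.symm
        have h3 := φ.injective h2
        rw [Prod.mk.injEq] at h3
        refine Prod.ext h3.1 ?_
        change o = o'
        rw [← hout o, ← hout o', hmkA]
        exact ⟨w, h3.2.symm⟩
    simpa using h1)
  have hEf : ∀ o, Emb o (f o) := fun o => (Finset.mem_filter.1 (hft o)).2
  choose ψ hψ using hEf
  have hinj : Function.Injective fun a => ψ (mkA a) a := by
    intro a a' h
    have h1 : mkA a = mkA a' := by
      apply hf
      rw [← (hψ _ a rfl).2.1, ← (hψ _ a' rfl).2.1]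
      exact congrArg mkB h
    have h2 : ψ (mkA a) a = ψ (mkA a) a' := by
      rw [show ψ (mkA a) a = ψ (mkA a') a' from h, h1]
    exact (hψ _ a rfl).2.2 a' h1.symm h2
  -- The matched orbit embeddings glue to an equivariant injection, and equal cardinalities make it
  -- bijective.
  have hcard : Fintype.card A = Fintype.card B := by
    have := Fintype.card_congr φ
    rw [Fintype.card_prod, Fintype.card_prod, Fintype.card_fin] at this
    exact Nat.eq_of_mul_eq_mul_left hn this
  refine ⟨Equiv.ofBijective _ ((Fintype.bijective_iff_injective_and_card _).2 ⟨hinj, hcard⟩),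
    fun w a => ?_⟩
  change ψ (mkA (f₁ w a)) (f₁ w a) = f₂ w (ψ (mkA a) a)
  rw [(hmkA (f₁ w a) a).2 ⟨w, rfl⟩]
  exact (hψ _ a rfl).1 w

end FixedPointSets

/-! ### The diagonal power. -/

namespace FixedPointSets

open Equiv Function

/-- The group of translations of `Fin t`. -/
def translations (t : ℕ) [NeZero t] : Subgroup (Perm (Fin t)) where
  carrier := {π | ∃ c, Equiv.addRight c = π}
  one_mem' := ⟨0, Equiv.addRight_zero⟩
  mul_mem' := by
    rintro _ _ ⟨a, rfl⟩ ⟨b, rfl⟩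
    exact ⟨b + a, Equiv.addRight_add b a⟩
  inv_mem' := by
    rintro _ ⟨a, rfl⟩
    exact ⟨-a, (Equiv.addRight_symm a).symm⟩

theorem isPGroup_translations {p t : ℕ} [NeZero t] {i : ℕ} (ht : t = p ^ i) :
    IsPGroup p (translations t) := by
  rintro ⟨_, c, rfl⟩
  refine ⟨i, Subtype.ext ?_⟩
  change Equiv.addRight c ^ p ^ i = 1
  have hpow : ∀ n : ℕ, Equiv.addRight c ^ n = Equiv.addRight (n • c) := by
    intro n
    induction n with
    | zero => rw [pow_zero, zero_nsmul, Equiv.addRight_zero]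
    | succ n ih => rw [pow_succ, ih, succ_nsmul', Equiv.addRight_add]
  have : t • c = 0 := by
    have := card_nsmul_eq_zero (x := c)
    rwa [Fintype.card_fin] at this
  rw [hpow, ← ht, this, Equiv.addRight_zero]

section Diagonal

variable {q : ℕ} {Y : Set (Perm ℕ)} {t : ℕ} {σ : Fin t → Perm ℕ}

/-- Translations act transitively on `Fin t`, so invariant coordinates are all equal. -/
theorem diagPower_eq_invariantPower [NeZero t] :
    diagPower Y σ = invariantPower Y σ (translations t) := by
  ext g
  constructor
  · rintro ⟨y, hy, rfl⟩
    exact ⟨_, fun _ => hy, fun _ _ _ => rfl, rfl⟩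
  · rintro ⟨y, hy, hyP, rfl⟩
    refine ⟨y 0, hy 0, congrArg _ (funext fun i => ?_)⟩
    have := hyP _ ⟨i, rfl⟩ 0
    rwa [Equiv.coe_addRight, show (fun x => x + i) 0 = i from zero_add i] at this

/-- Two `Y`-indexed families of permutations of a finite set are conjugate if their diagonals are
conjugate. -/
theorem exists_conj_of_conj_embed (hY : Y ∈ familyF) (hσ : IsPlacement Y σ) (ht : 1 ≤ t)
    (α : Y → Y) {g : Perm ℕ} (hg : g ∈ symOn (blockUnion (setSupp Y) σ))
    (hgα : ∀ y : Y, g * (embed σ fun _ => (y : Perm ℕ)) * g⁻¹ = embed σ fun _ => (α y : Perm ℕ)) :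
    ∃ h ∈ groupG Y, ∀ y : Y, h * y * h⁻¹ = α y := by
  classical
  have hd := hσ.disjointBlocks
  have hspec := fun y : Y => hd.embed_spec (y := fun _ => (y : Perm ℕ)) fun _ => mem_symOn_of_mem y.2
  have := (finite_setSupp hY).to_subtype
  let f : Y → Perm (setSupp Y) := fun y =>
    (y : Perm ℕ).subtypePerm (apply_mem_of_mem_symOn (mem_symOn_of_mem y.2))
  have hφ : ∀ x : Fin t × setSupp Y, ∃ z : Fin t × setSupp Y, σ z.1 z.2 = g (σ x.1 x.2) := by
    intro x
    obtain ⟨j, m, hm, h⟩ := mem_blockUnion.1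
      ((apply_mem_of_mem_symOn hg _).2 (apply_mem_blockUnion (σ := σ) x.1 x.2.2))
    exact ⟨(j, ⟨m, hm⟩), h⟩
  choose φ hφ using hφ
  have hinj : ∀ x z : Fin t × setSupp Y, σ x.1 x.2 = σ z.1 z.2 → x = z := fun x z h =>
    Prod.ext (hd.eq x.2.2 z.2.2 h).1 (Subtype.ext (hd.eq x.2.2 z.2.2 h).2)
  have hφinj : Function.Injective φ := fun x z h =>
    hinj x z (g.injective (by rw [← hφ, ← hφ, h]))
  have hof : ∀ y i a, φ (i, f y a) = ((φ (i, a)).1, f (α y) (φ (i, a)).2) := by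
    intro y i a
    apply hinj
    rw [hφ]
    change g (σ i ((y : Perm ℕ) a)) = σ (φ (i, a)).1 ((α y : Perm ℕ) (φ (i, a)).2)
    rw [← (hspec y).2 i a a.2, ← (hspec (α y)).2 _ _ (φ (i, a)).2.2, hφ, ← hgα]
    simp
  -- The free group on `Y` acts on the support through `y` and through `α y`. The permutation `g`
  -- identifies `t` copies of the first action with `t` copies of the second, and cancellation
  -- yields one conjugating permutation.
  obtain ⟨e, he⟩ := exists_equivariant_equiv_of_prod (FreeGroup.lift f)
    (FreeGroup.lift fun y => f (α y)) ht
    (Equiv.ofBijective φ (Finite.injective_iff_bijective.1 hφinj)) (by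
      intro w
      simp only [Equiv.ofBijective_apply]
      induction w using FreeGroup.induction_on with
      | C1 => intro i a; simp
      | of y => intro i a; simpa using hof y i a
      | inv_of y _ =>
        intro i a
        have := hof y i ((f y)⁻¹ a)
        rw [show f y ((f y)⁻¹ a) = a from (f y).apply_symm_apply a] at this
        simp [this]
      | mul v w hv hw => intro i a; simp [hv, hw])
  have he' : ∀ y a, e (f y a) = f (α y) (e a) := fun y a => by simpa using he (FreeGroup.of y) a
  refine ⟨Perm.ofSubtype e, mem_symOn.2 fun n hn => Perm.ofSubtype_apply_of_not_mem e hn,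
    fun y => ?_⟩
  rw [mul_inv_eq_iff_eq_mul]
  ext n
  rw [Perm.mul_apply, Perm.mul_apply]
  by_cases hn : n ∈ setSupp Y
  · have := congrArg Subtype.val (he' y ⟨n, hn⟩)
    rw [Perm.ofSubtype_apply_of_mem e hn, Perm.ofSubtype_apply_of_mem e
      ((apply_mem_of_mem_symOn (mem_symOn_of_mem y.2) n).2 hn)]
    exact this
  · rw [mem_symOn.1 (mem_symOn_of_mem y.2) n hn, Perm.ofSubtype_apply_of_not_mem e hn,
      mem_symOn.1 (mem_symOn_of_mem (α y).2) n hn]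

theorem setSupp_diagPower (hY : Y ∈ familyS q) (hσ : IsPlacement Y σ) (ht : 1 ≤ t) :
    setSupp (diagPower Y σ) = blockUnion (setSupp Y) σ := by
  have : NeZero t := ⟨by omega⟩
  rw [diagPower_eq_invariantPower]
  exact (invariantPower_mem_familyS hY hσ ht _).2

/-- In a decomposition every block lies on one side, because `Y` is irreducible, and both sides
contain a block. Gluing `y` on one block to `y'` on another keeps the coordinates equal, so `y =
y'`; and for `t = 1` there is only one block. -/
theorem isIrreducibleSet_diagPower (hY : Y ∈ familyS q) (hirr : IsIrreducibleSet Y)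
    (hσ : IsPlacement Y σ) (ht : 1 ≤ t) (h : 1 < Y.ncard ∨ t = 1) :
    IsIrreducibleSet (diagPower Y σ) := by
  by_contra hred
  obtain ⟨V, hVU, ⟨n₁, hn₁⟩, ⟨n₀, hn₀U, hn₀⟩, hV, hglue⟩ := exists_of_not_isIrreducibleSet hred
  rw [setSupp_diagPower hY hσ ht] at hVU hn₀U
  have hd := hσ.disjointBlocks
  have hspec := fun (y : Perm ℕ) (hy : y ∈ Y) =>
    hd.embed_spec (y := fun _ => y) fun _ => mem_symOn_of_mem hy
  have hblock : ∀ i, (∀ m ∈ setSupp Y, σ i m ∉ V) ∨ ∀ m ∈ setSupp Y, σ i m ∈ V := by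
    intro i
    have := hirr.eq_empty_or_eq hY (V := {m | m ∈ setSupp Y ∧ σ i m ∈ V}) (fun m hm => hm.1)
      (fun y hy => apply_mem_iff_of_finite
        ((finite_setSupp hY.1).subset fun m hm => hm.1) fun m hm => by
          refine ⟨(apply_mem_of_mem_symOn (mem_symOn_of_mem hy) m).2 hm.1, ?_⟩
          rw [← (hspec y hy).2 i m hm.1, hV _ ⟨y, hy, rfl⟩]
          exact hm.2) (by
        intro y hy y' hy'
        obtain ⟨_, ⟨y'', hy'', rfl⟩, h1, h2⟩ := hglue _ ⟨y, hy, rfl⟩ _ ⟨y', hy', rfl⟩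
        refine ⟨y'', hy'', fun m hm => ?_, fun m hm hmV => ?_⟩
        · have := h1 (σ i m) hm.2
          rw [(hspec _ hy'').2 i m hm.1, (hspec _ hy).2 i m hm.1] at this
          exact (σ i).injective this
        · have := h2 (σ i m) fun h => hmV ⟨hm, h⟩
          rw [(hspec _ hy'').2 i m hm, (hspec _ hy').2 i m hm] at this
          exact (σ i).injective this)
    rcases this with h | h
    · exact Or.inl fun m hm hmV => Set.notMem_empty m (h ▸ ⟨hm, hmV⟩)
    · exact Or.inr fun m hm => (h.symm ▸ hm : m ∈ {m | m ∈ setSupp Y ∧ σ i m ∈ V}).2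
  obtain ⟨i₁, m₁, hm₁, rfl⟩ := mem_blockUnion.1 (hVU hn₁)
  obtain ⟨i₀, m₀, hm₀, rfl⟩ := mem_blockUnion.1 hn₀U
  have h₁ := (hblock i₁).resolve_left fun h => h m₁ hm₁ hn₁
  have h₀ := (hblock i₀).resolve_right fun h => hn₀ (h m₀ hm₀)
  rcases h with h | rfl
  · obtain ⟨y, y', hy, hy', hne⟩ := (Set.one_lt_ncard_iff hY.1.1).1 h
    obtain ⟨_, ⟨y'', hy'', rfl⟩, h1, h2⟩ := hglue _ ⟨y, hy, rfl⟩ _ ⟨y', hy', rfl⟩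
    apply hne
    ext m
    by_cases hm : m ∈ setSupp Y
    · have h3 := h1 _ (h₁ m hm)
      have h4 := h2 _ (h₀ m hm)
      rw [(hspec _ hy'').2 _ m hm, (hspec _ hy).2 _ m hm] at h3
      rw [(hspec _ hy'').2 _ m hm, (hspec _ hy').2 _ m hm] at h4
      exact ((σ i₁).injective h3).symm.trans ((σ i₀).injective h4)
    · rw [mem_symOn.1 (mem_symOn_of_mem hy) m hm, mem_symOn.1 (mem_symOn_of_mem hy') m hm]
  · rw [Subsingleton.elim i₁ i₀] at h₁
    exact h₀ m₀ hm₀ (h₁ m₀ hm₀)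

variable {k : Type*} [Field k]

/-- Under the bijection of `Y` with its diagonal, each permutation induced on the diagonal comes
from conjugation in `Sym(supp Y)`, by `exists_conj_of_conj_embed`. So the idempotent of `Y` is
simply transported. -/
theorem hasProjectiveIdempotent_diagPower (hY : Y ∈ familyS q) (hσ : IsPlacement Y σ)
    (ht : 1 ≤ t) [Finite Y] [Finite (diagPower Y σ)] (h : HasProjectiveIdempotent k (conjPerms Y)) :
    HasProjectiveIdempotent k (conjPerms (diagPower Y σ)) := by
  have hd := hσ.disjointBlocks
  let ε : Y ≃ diagPower Y σ := Equiv.ofBijective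
    (fun y => ⟨embed σ fun _ => (y : Perm ℕ), y, y.2, rfl⟩) (by
      constructor
      · intro y y' h
        have := hd.embed_injective (fun _ => mem_symOn_of_mem y.2)
          (fun _ => mem_symOn_of_mem y'.2) (congrArg Subtype.val h)
        exact Subtype.ext (congrFun this ⟨0, ht⟩)
      · rintro ⟨_, y, hy, rfl⟩
        exact ⟨⟨y, hy⟩, rfl⟩)
  refine h.of_equiv ε ?_
  rintro γ ⟨g, hg, hgγ⟩
  have hgU : g ∈ symOn (blockUnion (setSupp Y) σ) := setSupp_diagPower hY hσ ht ▸ hg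
  obtain ⟨u, hu, hconj⟩ := exists_conj_of_conj_embed hY.1 hσ ht ((ε.trans γ).trans ε.symm) hgU
    fun y => (hgγ (ε y)).trans (congrArg Subtype.val (ε.apply_symm_apply (γ (ε y)))).symm
  exact ⟨(ε.trans γ).trans ε.symm, ⟨u, hu, hconj⟩, fun y => ε.apply_symm_apply _⟩

end Diagonal

end FixedPointSets

theorem theorem4p18 {k : Type*} [Field k] (p : ℕ) (hp : p.Prime) [CharP k p]
    (q : ℕ) (hq : 2 ≤ q) (Y : Set (Equiv.Perm ℕ)) (hY : Y ∈ familyS q)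
    (hYirr : IsIrreducibleSet Y) (hYexact : IsExact p Y) (hYfix : IsFixedPointSet k Y)
    (s : ℕ) (hs : 1 ≤ s) (hsp : s < p) (t : ℕ) (ht : ∃ i : ℕ, t = p ^ i) :
    (∀ σ : Fin s → Equiv.Perm ℕ, IsPlacement Y σ →
      starPower Y σ ∈ familyS q ∧ IsFixedPointSet k (starPower Y σ)) ∧
    (∀ σ : Fin t → Equiv.Perm ℕ, IsPlacement Y σ →
      diagPower Y σ ∈ familyS q ∧ IsFixedPointSet k (diagPower Y σ) ∧
      (1 < Y.ncard ∨ t = 1 → IsIrreducibleSet (diagPower Y σ))) := by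
  have := Fact.mk hp
  have := hY.1.1.to_subtype
  constructor
  · intro σ hσ
    have hstar : starPower Y σ ∈ familyS q :=
      starPower_eq_invariantPower ▸ (invariantPower_mem_familyS hY hσ hs ⊥).1
    have := hstar.1.1.to_subtype
    have hproj := hasProjectiveIdempotent_starPower (k := k) hY hYirr hσ hs hsp
    refine ⟨hstar, ?_⟩
    revert this
    rw [starPower_eq_invariantPower]
    intro this hproj
    exact isFixedPointSet_invariantPower hq hY hσ hs hYexact hYfix IsPGroup.of_bot hproj
  · intro σ hσ
    obtain ⟨i, hi⟩ := ht
    have ht : 1 ≤ t := hi ▸ Nat.one_le_pow _ _ hp.pos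
    have : NeZero t := ⟨by omega⟩
    have hdiag : diagPower Y σ ∈ familyS q :=
      diagPower_eq_invariantPower (σ := σ) ▸ (invariantPower_mem_familyS hY hσ ht _).1
    have := hdiag.1.1.to_subtype
    have hproj := hasProjectiveIdempotent_diagPower (k := k) hY hσ ht
    refine ⟨hdiag, ?_, isIrreducibleSet_diagPower hY hYirr hσ ht⟩
    revert this
    rw [diagPower_eq_invariantPower (t := t)]
    intro this hproj
    exact isFixedPointSet_invariantPower hq hY hσ ht hYexact hYfix (isPGroup_translations hi) hproj
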